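/- Let $\mathfrak g$ be a complex simple Lie algebra of type $A$, $D$ or $E$ with Cartan subalgebra $\mathfrak h$, rank $\ell=\dim\mathfrak h$ and Coxeter number $h$ (so that $\ell(h+1)=\dim\mathfrak g$), and assume that $h$ is even (this excludes only $A_\ell$ with $\ell$ even); put $g=h/2$. Let $\Delta$ be the set of roots, $\Delta_+$ a system of positive roots, $\Pi=\{\alpha_i\mid i\in I\}$ the corresponding simple roots and $\psi$ the highest root. Let $\Pi=\Pi_1\sqcup\Pi_2$, $I=I_1\sqcup I_2$, $\Pi_k=\{\alpha_i\mid i\in I_k\}$, be the partition such that distinct roots in the same $\Pi_k$ are orthogonal and all roots of $\Pi_2$ are orthogonal to $\psi$. Let $s_i$ be the reflection in $\alpha_i$, let $\tau_k=\prod_{i\in I_k}s_i$, let $\sigma=\tau_2\tau_1$ (a Coxeter element), and let $Z$ be the cyclic group generated by $\sigma$. Put $\beta_i=\alpha_i$ for $i\in I_1$, $\beta_i=-\alpha_i$ for $i\in I_2$, and $(Z\cdot\beta_i)_+=\Delta_+\cap Z\cdot\beta_i$. For every $\varphi\in\Delta_+$ there is a unique $i=i_\varphi\in I$ with $\varphi\in(Z\cdot\beta_i)_+$,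 and a unique integer $n(\varphi)$ with $1\le n(\varphi)\le h$ such that: if $i_\varphi\in I_1$, then $n(\varphi)$ is odd and $\sigma^{(n(\varphi)-1)/2}(\varphi)=\beta_{i_\varphi}$; if $i_\varphi\in I_2$, then $n(\varphi)$ is even and $\sigma^{n(\varphi)/2}(\varphi)=\beta_{i_\varphi}$. Moreover, for every $i\in I_1$ the map $(Z\cdot\beta_i)_+\to\{0,1,\dots,g-1\}$, $\varphi\mapsto (n(\varphi)-1)/2$, is a bijection, and for every $i\in I_2$ the map $(Z\cdot\beta_i)_+\to\{1,\dots,g\}$, $\varphi\mapsto n(\varphi)/2$, is a bijection. -/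

import Mathlib

open Module

noncomputable section

namespace CoxeterOrbit

section RootSystem

variable {ι R M N : Type*} [CommRing R] [AddCommGroup M] [Module R M]
  [AddCommGroup N] [Module R N] {P : RootPairing ι R M N}

/-- The set `Δ` of roots, as vectors. -/
def roots (P : RootPairing ι R M N) : Set M := Set.range P.root

/-- The set `Δ₊` of positive roots with respect to the simple roots of `b`: the roots which are
sums of simple roots. -/
def positiveRoots (b : P.Base) : Set M :=
  {φ | φ ∈ roots P ∧ φ ∈ AddSubmonoid.closure (P.root '' b.support)}

/-- `ψ` (the index of) the highest root: `ψ - φ` is a sum of simple roots for every root `φ`. -/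
def IsHighestRoot (b : P.Base) (ψ : ι) : Prop :=
  ∀ j : ι, P.root ψ - P.root j ∈ AddSubmonoid.closure (P.root '' b.support)

/-- The partition `Π = Π₁ ∪ Π₂` of the simple roots into two sets, each consisting of pairwise
orthogonal roots, where moreover all roots of `Π₂` are orthogonal to the highest root.
A part may be empty. -/
structure SimplePartition (b : P.Base) where
  /-- The indices of the simple roots in `Π₁`. -/
  I₁ : Finset ι
  /-- The indices of the simple roots in `Π₂`. -/
  I₂ : Finset ι
  mem_support_iff : ∀ i, i ∈ b.support ↔ i ∈ I₁ ∨ i ∈ I₂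
  disjoint : Disjoint I₁ I₂
  orthogonal₁ : (I₁ : Set ι).Pairwise P.IsOrthogonal
  orthogonal₂ : (I₂ : Set ι).Pairwise P.IsOrthogonal
  orthogonal_highest : ∀ ψ, IsHighestRoot b ψ → ∀ i ∈ I₂, P.IsOrthogonal i ψ

/-- The product of the (commuting) reflections in a set of pairwise orthogonal roots. -/
def reflectionProd (P : RootPairing ι R M N) (s : Finset ι)
    (hs : (s : Set ι).Pairwise P.IsOrthogonal) : M ≃ₗ[R] M :=
  s.noncommProd (fun i ↦ P.reflection i)
    (fun _ hi _ hj hij ↦ RootPairing.isOrthogonal_comm P _ _ (hs hi hj hij))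

namespace SimplePartition

variable {b : P.Base} (c : SimplePartition b)

/-- `τ₁`, the product of the simple reflections `s_i`, `i ∈ I₁`. -/
def τ₁ : M ≃ₗ[R] M := reflectionProd P c.I₁ c.orthogonal₁

/-- `τ₂`, the product of the simple reflections `s_i`, `i ∈ I₂`. -/
def τ₂ : M ≃ₗ[R] M := reflectionProd P c.I₂ c.orthogonal₂

/-- The Coxeter element `σ = τ₂ τ₁` (first `τ₁`, then `τ₂`), acting on the space of roots. -/
def σ : M ≃ₗ[R] M := c.τ₂ * c.τ₁

open Classical in
/-- `β_i = α_i` for `i ∈ I₁`, and `β_i = -α_i` for `i ∈ I₂`. -/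
def β (i : ι) : M := if i ∈ c.I₁ then P.root i else -P.root i

/-- `Z · β_i`, the orbit of `β_i` under the cyclic group `Z` generated by `σ`. -/
def orbit (i : ι) : Set M := MulAction.orbit (Subgroup.zpowers c.σ) (c.β i)

/-- `(Z · β_i)₊ = Δ₊ ∩ Z · β_i`. -/
def posOrbit (i : ι) : Set M := positiveRoots b ∩ c.orbit i

/-- The defining property of the integer `n = n(φ)` attached to a positive root `φ`, where `h` is
the Coxeter number: `1 ≤ n ≤ h`, and if `φ ∈ (Z · β_i)₊` with `i ∈ I₁` (respectively `i ∈ I₂`) then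
`n` is odd and `σ ^ ((n - 1) / 2) φ = β_i` (respectively `n` is even and `σ ^ (n / 2) φ = β_i`). -/
def IsLevel (h : ℕ) (φ : M) (n : ℕ) : Prop :=
  1 ≤ n ∧ n ≤ h ∧
    ((∃ i ∈ c.I₁, φ ∈ c.posOrbit i ∧ Odd n ∧ (c.σ ^ ((n - 1) / 2)) φ = c.β i) ∨
     (∃ i ∈ c.I₂, φ ∈ c.posOrbit i ∧ Even n ∧ (c.σ ^ (n / 2)) φ = c.β i))

/-- The integer `n(φ)`. It is meaningful if there is exactly one `n` with `IsLevel h φ n`. -/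
def level (h : ℕ) (φ : M) : ℕ := sInf {n | c.IsLevel h φ n}

end SimplePartition

/-- The Cartan matrix of the root system is, up to the numbering of the simple roots, the given
matrix. -/
def HasCartanMatrix [P.IsCrystallographic] (b : P.Base) {n : ℕ} (C : Matrix (Fin n) (Fin n) ℤ) :
    Prop :=
  ∃ e : b.support ≃ Fin n, ∀ i j, b.cartanMatrix i j = C (e i) (e j)

/-- The root system is of type `A`, `D` or `E`. -/
def IsTypeADE [P.IsCrystallographic] (b : P.Base) : Prop :=
  (∃ n, 1 ≤ n ∧ HasCartanMatrix b (CartanMatrix.A n)) ∨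
  (∃ n, 4 ≤ n ∧ HasCartanMatrix b (CartanMatrix.D n)) ∨
  HasCartanMatrix b CartanMatrix.E₆ ∨
  HasCartanMatrix b CartanMatrix.E₇ ∨
  HasCartanMatrix b CartanMatrix.E₈

end RootSystem

/-- The Coxeter number `h` of a complex simple Lie algebra `𝔤` with Cartan subalgebra `H`: the
number determined by `ℓ (h + 1) = dim 𝔤`, where `ℓ = dim H` is the rank of `𝔤`. -/
def coxeterNumber {𝔤 : Type*} [LieRing 𝔤] [LieAlgebra ℂ 𝔤] (H : LieSubalgebra ℂ 𝔤) : ℕ :=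
  finrank ℂ 𝔤 / finrank ℂ H - 1

end CoxeterOrbit

end

/-! The argument takes place in the Coxeter plane. In types A, D, E the Cartan matrix C is
symmetric, so the adjacency matrix 2 - C of the connected Dynkin diagram has an eigenvector with
positive entries; its eigenvalue is 2 cos θ with 0 < θ ≤ π/2. Restricting this eigenvector to Π₁ and
to Π₂ gives functionals `D₁`, `D₂` spanning a plane on which σ acts as a rotation by 2θ. For 0 < t <
1 the combination `G t` is positive on positive roots, so the sign of any root can be read off in
the plane.

Let `start i` be the positive root in the orbit of β_i that σ makes negative. On σ^{-k}(`start i`),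
`G t` is a positive multiple of sin((t + 2k + ε)θ), where ε is the colour of i. Since `G t` vanishes
on no root, θ = π/m for an integer m (`exists_mul_angle_eq_pi`). Hence σ^m = 1, and the positive
roots are exactly the σ^{-k}(`start i`) with 2k + ε < m, each obtained once
(`exists_eq_σ_inv_pow_start`, `σ_inv_pow_start_inj`). Counting them gives |Δ| = ℓm
(`CoxeterPlane.card_eq`), and dim 𝔤 = ℓ + |Δ| then yields m = h. For h = 2g every run is k = 0, ...,
g - 1 and n(φ) = 2k + 1 + ε (`isLevel_iff`). -/

open Module

noncomputable section

namespace CoxeterOrbit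

/-! ### Signs of roots under words in the simple reflections. -/

section Positivity

variable {ι M N : Type*} [AddCommGroup M] [Module ℂ M]
  [AddCommGroup N] [Module ℂ N] {P : RootPairing ι ℂ M N}

lemma reflection_mem_roots (i : ι) {φ : M} (hφ : φ ∈ roots P) : P.reflection i φ ∈ roots P :=
  P.mapsTo_reflection_root i hφ

lemma neg_mem_roots {φ : M} (hφ : φ ∈ roots P) : -φ ∈ roots P :=
  P.neg_mem_range_root_iff.mpr hφ

lemma ne_zero_of_mem_roots {φ : M} (hφ : φ ∈ roots P) : φ ≠ 0 := by
  obtain ⟨i, rfl⟩ := hφ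
  exact P.ne_zero i

variable (b : P.Base)

lemma exists_eq_sum_of_mem_closure {x : M} (hx : x ∈ AddSubmonoid.closure (P.root '' b.support)) :
    ∃ f : ι → ℕ, x = ∑ j ∈ b.support, f j • P.root j := by
  classical
  induction hx using AddSubmonoid.closure_induction with
  | mem x hx =>
    obtain ⟨i, hi, rfl⟩ := hx
    refine ⟨Pi.single i 1, ?_⟩
    rw [Finset.sum_eq_single_of_mem i hi (by simp_all)]
    simp
  | zero => exact ⟨0, by simp⟩
  | add x y _ _ hx hy =>
    obtain ⟨f, rfl⟩ := hx
    obtain ⟨g, rfl⟩ := hy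
    exact ⟨f + g, by simp [add_smul, Finset.sum_add_distrib]⟩

lemma root_mem_positiveRoots_iff {i : ι} : P.root i ∈ positiveRoots b ↔ b.IsPos i := by
  have key (j : ι) (hj : P.root j ∈ AddSubmonoid.closure (P.root '' b.support)) : b.IsPos j := by
    obtain ⟨f, hf⟩ := exists_eq_sum_of_mem_closure b hj
    rw [b.isPos_iff', RootPairing.Base.height_eq_sum (f := fun j ↦ (f j : ℤ)) (by simpa using hf)]
    positivity
  refine ⟨fun h ↦ key i h.2, fun h ↦ ⟨⟨i, rfl⟩, ?_⟩⟩
  refine (b.root_mem_or_neg_mem i).resolve_right fun hneg ↦ ?_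
  let := P.indexNeg
  have : b.IsPos (-i) := key (-i) (by simpa using hneg)
  exact (RootPairing.Base.IsPos.neg_iff_not b i).mp this h

lemma positiveRoots_subset_roots : positiveRoots b ⊆ roots P := fun _ h ↦ h.1

variable {b}

lemma root_mem_positiveRoots {i : ι} (hi : i ∈ b.support) : P.root i ∈ positiveRoots b :=
  ⟨⟨i, rfl⟩, AddSubmonoid.subset_closure ⟨i, hi, rfl⟩⟩

lemma neg_mem_positiveRoots_iff {φ : M} (hφ : φ ∈ roots P) :
    -φ ∈ positiveRoots b ↔ φ ∉ positiveRoots b := by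
  obtain ⟨i, rfl⟩ := hφ
  let := P.indexNeg
  have : -P.root i = P.root (-i) := by simp
  rw [this, root_mem_positiveRoots_iff, root_mem_positiveRoots_iff,
    RootPairing.Base.IsPos.neg_iff_not]

lemma map_pos_of_mem_positiveRoots (f : M →+ ℝ) (hf : ∀ i ∈ b.support, 0 < f (P.root i))
    {φ : M} (hφ : φ ∈ positiveRoots b) : 0 < f φ := by
  have hφ₀ := ne_zero_of_mem_roots hφ.1
  obtain ⟨n, rfl⟩ := exists_eq_sum_of_mem_closure b hφ.2
  obtain ⟨i, hi, hi'⟩ := Finset.exists_ne_zero_of_sum_ne_zero hφ₀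
  rw [map_sum]
  refine Finset.sum_pos' (fun j hj ↦ ?_) ⟨i, hi, ?_⟩
  · rw [map_nsmul]
    exact nsmul_nonneg (hf j hj).le _
  · rw [map_nsmul]
    refine nsmul_pos (hf i hi) ?_
    rintro h
    simp [h] at hi'

/-- The conjugation rule w s_α w⁻¹ = s_{wα}, in a form without inverses; it drives the deletion
argument below. -/
lemma list_prod_mul_reflection (l : List ι) {i j : ι}
    (h : (l.map P.reflection).prod (P.root i) = P.root j) :
    (l.map P.reflection).prod * P.reflection i = P.reflection j * (l.map P.reflection).prod := by
  induction l generalizing j with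
  | nil =>
    have : i = j := P.root.injective (by simpa using h)
    simp [this]
  | cons k l ih =>
    have h₁ : (l.map P.reflection).prod (P.root i) = P.root (P.reflectionPerm k j) := by
      rw [P.root_reflectionPerm, ← h]
      simp
    have hk : P.reflection k * P.reflection k = 1 := by
      rw [← sq, P.reflection_sq]
    rw [List.map_cons, List.prod_cons, mul_assoc, ih h₁, P.reflection_reflectionPerm]
    simp only [← mul_assoc]
    rw [hk, one_mul]

section Finite

variable [Finite ι] [P.IsCrystallographic] [P.IsReduced]

lemma reflection_mem_positiveRoots {i : ι} (hi : i ∈ b.support) {φ : M}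
    (hφ : φ ∈ positiveRoots b) (hne : φ ≠ P.root i) : P.reflection i φ ∈ positiveRoots b := by
  obtain ⟨j, rfl⟩ := hφ.1
  rw [← P.root_reflectionPerm, root_mem_positiveRoots_iff]
  rw [root_mem_positiveRoots_iff] at hφ
  exact hφ.reflectionPerm hi (fun h ↦ hne (h ▸ rfl))

/-- A word in the simple reflections which makes a positive root negative passes through the simple
root at which the sign changes. -/
lemma exists_prefix_eq_root (l : List ι) (hl : ∀ i ∈ l, i ∈ b.support) {φ : M}
    (hφ : φ ∈ positiveRoots b) (hneg : (l.map P.reflection).prod φ ∉ positiveRoots b) :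
    ∃ l₁ j l₂, l = l₁ ++ j :: l₂ ∧ (l₂.map P.reflection).prod φ = P.root j := by
  induction l with
  | nil => exact absurd (by simpa using hφ) hneg
  | cons i l ih =>
    by_cases h : (l.map P.reflection).prod φ ∈ positiveRoots b
    · refine ⟨[], i, l, rfl, ?_⟩
      by_contra hne
      exact hneg (by simpa using reflection_mem_positiveRoots (hl i (by simp)) h hne)
    · obtain ⟨l₁, j, l₂, rfl, h₂⟩ := ih (fun j hj ↦ hl j (by simp [hj])) h
      exact ⟨i :: l₁, j, l₂, rfl, h₂⟩

/-- A product of simple reflections which preserves the positive roots is trivial. -/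
lemma list_prod_eq_one_of_mapsTo (l : List ι) (hl : ∀ i ∈ l, i ∈ b.support)
    (h : ∀ φ ∈ positiveRoots b, (l.map P.reflection).prod φ ∈ positiveRoots b) :
    (l.map P.reflection).prod = 1 := by
  induction hn : l.length using Nat.strong_induction_on generalizing l with
  | _ n ih =>
  rcases List.eq_nil_or_concat' l with rfl | ⟨l, i, rfl⟩
  · simp
  have hi : i ∈ b.support := hl i (by simp)
  have hroots : (l.map P.reflection).prod (P.root i) ∈ roots P := by
    clear h hl hn
    induction l with
    | nil => exact ⟨i, rfl⟩
    | cons j l ih => simpa using reflection_mem_roots j ih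
  have hneg : (l.map P.reflection).prod (P.root i) ∉ positiveRoots b := by
    rw [← neg_mem_positiveRoots_iff hroots]
    simpa using h _ (root_mem_positiveRoots hi)
  -- Deletion: a suffix l₂ of the word takes α_i to a simple root α_j, so s_j l₂ s_i = l₂ and the
  -- word loses two letters.
  obtain ⟨l₁, j, l₂, rfl, hj⟩ := exists_prefix_eq_root l (fun j hj ↦ hl j (by simp [hj]))
    (root_mem_positiveRoots hi) hneg
  have hjj : P.reflection j * P.reflection j = 1 := by
    rw [← sq, P.reflection_sq]
  have heq : ((l₁ ++ j :: l₂ ++ [i]).map P.reflection).prod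
      = ((l₁ ++ l₂).map P.reflection).prod := by
    simp only [List.map_append, List.map_cons, List.prod_append, List.prod_cons, List.map_nil,
      List.prod_nil, mul_one, mul_assoc]
    rw [list_prod_mul_reflection l₂ hj, ← mul_assoc (P.reflection j), hjj, one_mul]
  rw [heq] at h ⊢
  refine ih _ ?_ _ (fun k hk ↦ hl k ?_) h rfl
  · simp at hn ⊢
    lia
  · simp at hk ⊢
    tauto

/-- An element of the monoid generated by the simple reflections which preserves the positive roots
is trivial. -/
lemma eq_one_of_mem_closure_of_mapsTo {w : M ≃ₗ[ℂ] M}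
    (hw : w ∈ Submonoid.closure (P.reflection '' b.support))
    (h : ∀ φ ∈ positiveRoots b, w φ ∈ positiveRoots b) : w = 1 := by
  obtain ⟨l, hl, rfl⟩ := Submonoid.exists_list_of_mem_closure hw
  obtain ⟨l', rfl, hl'⟩ : ∃ l' : List ι, l'.map P.reflection = l ∧ ∀ i ∈ l', i ∈ b.support := by
    clear h hw
    induction l with
    | nil => exact ⟨[], rfl, by simp⟩
    | cons x l ih =>
      obtain ⟨l', rfl, hl'⟩ := ih fun y hy ↦ hl y (by simp [hy])
      obtain ⟨i, hi, rfl⟩ := hl x (by simp)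
      exact ⟨i :: l', rfl, by simpa using ⟨hi, hl'⟩⟩
  exact list_prod_eq_one_of_mapsTo l' hl' h

end Finite

/-! ### Products of reflections in pairwise orthogonal roots. -/

section ReflectionProd

variable (P) in
lemma reflectionProd_empty (h : ((∅ : Finset ι) : Set ι).Pairwise P.IsOrthogonal) :
    reflectionProd P ∅ h = 1 :=
  Finset.noncommProd_empty _ _

variable (P) in
lemma reflectionProd_insert [DecidableEq ι] {a : ι} {s : Finset ι} (ha : a ∉ s)
    (hs : ((insert a s : Finset ι) : Set ι).Pairwise P.IsOrthogonal)
    (hs' : (s : Set ι).Pairwise P.IsOrthogonal) :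
    reflectionProd P (insert a s) hs = P.reflection a * reflectionProd P s hs' :=
  Finset.noncommProd_insert_of_notMem _ _ _ _ ha

lemma reflectionProd_apply (s : Finset ι) (hs : (s : Set ι).Pairwise P.IsOrthogonal) (x : M) :
    reflectionProd P s hs x = x - ∑ i ∈ s, P.coroot' i x • P.root i := by
  classical
  induction s using Finset.induction_on with
  | empty => simp [reflectionProd_empty]
  | insert a s ha ih =>
    have hs' : (s : Set ι).Pairwise P.IsOrthogonal := hs.mono (by simp)
    have hz : P.coroot' a (∑ i ∈ s, P.coroot' i x • P.root i) = 0 := by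
      rw [map_sum]
      refine Finset.sum_eq_zero fun i hi ↦ ?_
      have : P.IsOrthogonal i a := hs (by simp [hi]) (by simp) (by rintro rfl; exact ha hi)
      simp [this.1]
    rw [reflectionProd_insert P ha hs hs', LinearEquiv.mul_apply, ih hs', P.reflection_apply,
      Finset.sum_insert ha, map_sub, hz]
    module

lemma coroot'_reflectionProd_of_mem {s : Finset ι} (hs : (s : Set ι).Pairwise P.IsOrthogonal)
    {i : ι} (hi : i ∈ s) (x : M) :
    P.coroot' i (reflectionProd P s hs x) = -P.coroot' i x := by
  classical
  rw [reflectionProd_apply, map_sub, map_sum, Finset.sum_eq_single_of_mem i hi]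
  · simp
    ring
  · intro j hj hne
    simp [(hs hj hi hne).1]

lemma reflectionProd_reflectionProd (s : Finset ι) (hs : (s : Set ι).Pairwise P.IsOrthogonal)
    (x : M) : reflectionProd P s hs (reflectionProd P s hs x) = x := by
  rw [reflectionProd_apply s hs (reflectionProd P s hs x), Finset.sum_congr rfl fun i hi ↦ by
    rw [coroot'_reflectionProd_of_mem hs hi x], reflectionProd_apply]
  simp

lemma reflectionProd_root_of_mem {s : Finset ι} (hs : (s : Set ι).Pairwise P.IsOrthogonal)
    {i : ι} (hi : i ∈ s) : reflectionProd P s hs (P.root i) = -P.root i := by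
  classical
  rw [reflectionProd_apply, Finset.sum_eq_single_of_mem i hi]
  · simp
    module
  · intro j hj hne
    simp [(hs hj hi hne).2]

lemma reflectionProd_mem_roots (s : Finset ι) (hs : (s : Set ι).Pairwise P.IsOrthogonal) {φ : M}
    (hφ : φ ∈ roots P) : reflectionProd P s hs φ ∈ roots P := by
  classical
  induction s using Finset.induction_on with
  | empty => simpa [reflectionProd_empty] using hφ
  | insert a s ha ih =>
    have hs' : (s : Set ι).Pairwise P.IsOrthogonal := hs.mono (by simp)
    rw [reflectionProd_insert P ha hs hs']
    exact reflection_mem_roots a (ih hs')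

lemma reflectionProd_mem_closure {s : Finset ι} (hs : (s : Set ι).Pairwise P.IsOrthogonal)
    (hsb : s ⊆ b.support) :
    reflectionProd P s hs ∈ Submonoid.closure (P.reflection '' b.support) :=
  Submonoid.noncommProd_mem _ _ _ _ fun i hi ↦ Submonoid.subset_closure ⟨i, hsb hi, rfl⟩

/-- Each factor changes the sign of its own simple root only, and by orthogonality the remaining
factors fix that root. -/
lemma exists_eq_root_of_reflectionProd_notMem [Finite ι] [P.IsCrystallographic] [P.IsReduced]
    {s : Finset ι} (hs : (s : Set ι).Pairwise P.IsOrthogonal)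
    (hsb : s ⊆ b.support) {φ : M} (hφ : φ ∈ positiveRoots b)
    (hneg : reflectionProd P s hs φ ∉ positiveRoots b) : ∃ i ∈ s, φ = P.root i := by
  classical
  induction s using Finset.induction_on with
  | empty => exact absurd (by simpa [reflectionProd_empty] using hφ) hneg
  | insert a s ha ih =>
    have hs' : (s : Set ι).Pairwise P.IsOrthogonal := hs.mono (by simp)
    by_cases h : reflectionProd P s hs' φ ∈ positiveRoots b
    · rw [reflectionProd_insert P ha hs hs'] at hneg
      have h₁ : reflectionProd P s hs' φ = P.root a := by
        by_contra hne
        exact hneg (reflection_mem_positiveRoots (hsb (by simp)) h hne)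
      have h₂ : reflectionProd P s hs' (P.root a) = P.root a := by
        rw [reflectionProd_apply, Finset.sum_eq_zero, sub_zero]
        intro i hi
        have : P.IsOrthogonal i a := hs (by simp [hi]) (by simp) (by rintro rfl; exact ha hi)
        simp [this.2]
      exact ⟨a, by simp, (reflectionProd P s hs').injective (h₁.trans h₂.symm)⟩
    · obtain ⟨i, hi, rfl⟩ := ih hs' (fun i hi ↦ hsb (by simp [hi])) h
      exact ⟨i, by simp [hi], rfl⟩

end ReflectionProd

end Positivity

end CoxeterOrbit

namespace CoxeterOrbit

/-! ### A Perron–Frobenius eigenvector for symmetric matrices. -/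

section Perron

variable {n : Type*} [Fintype n] [DecidableEq n]

lemma reApplyInnerSelf_toEuclideanCLM (A : Matrix n n ℝ) (x : EuclideanSpace ℝ n) :
    (Matrix.toEuclideanCLM (𝕜 := ℝ) A).reApplyInnerSelf x = ∑ i, ∑ j, A i j * (x i * x j) := by
  rw [ContinuousLinearMap.reApplyInnerSelf_apply, PiLp.inner_apply]
  simp only [Matrix.ofLp_toEuclideanCLM, Matrix.mulVec, dotProduct, RCLike.re_to_real]
  refine Finset.sum_congr rfl fun i _ ↦ ?_
  simp only [RCLike.inner_apply, conj_trivial, Finset.mul_sum]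
  exact Finset.sum_congr rfl fun j _ ↦ by ring

/-- A symmetric matrix with nonnegative entries whose graph is connected has an eigenvector with
positive entries. -/
lemma exists_pos_eigenvector [Nonempty n] {A : Matrix n n ℝ} (hA : A.IsSymm)
    (hnonneg : ∀ i j, 0 ≤ A i j)
    (hconn : ∀ (p : n → Prop) (i j : n), p i → (∀ i j, p i → A j i ≠ 0 → p j) → p j) :
    ∃ (lam : ℝ) (d : n → ℝ), (∀ i, 0 < d i) ∧ ∀ i, ∑ j, A i j * d j = lam * d i := by
  set T : EuclideanSpace ℝ n →L[ℝ] EuclideanSpace ℝ n := Matrix.toEuclideanCLM (𝕜 := ℝ) A with hTdef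
  have hT : IsSelfAdjoint T := by
    rw [IsSelfAdjoint, hTdef, ← map_star]
    congr 1
  obtain ⟨x, hx, hmax⟩ := (isCompact_sphere (0 : EuclideanSpace ℝ n) 1).exists_isMaxOn
    (NormedSpace.sphere_nonempty.mpr zero_le_one) T.reApplyInnerSelf_continuous.continuousOn
  have hx1 : ‖x‖ = 1 := by simpa using hx
  -- The entries of A are nonnegative, so passing to absolute values does not decrease the quadratic
  -- form: y is again a maximiser on the sphere, hence an eigenvector.
  set y : EuclideanSpace ℝ n := WithLp.toLp 2 fun i ↦ |x i| with hy
  have hyi (i : n) : y i = |x i| := rfl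
  have hy1 : ‖y‖ = 1 := by
    rw [← hx1, EuclideanSpace.norm_eq, EuclideanSpace.norm_eq]
    simp [hyi]
  have hxy : T.reApplyInnerSelf x ≤ T.reApplyInnerSelf y := by
    rw [reApplyInnerSelf_toEuclideanCLM, reApplyInnerSelf_toEuclideanCLM]
    refine Finset.sum_le_sum fun i _ ↦ Finset.sum_le_sum fun j _ ↦ ?_
    rw [hyi, hyi, ← abs_mul]
    exact mul_le_mul_of_nonneg_left (le_abs_self _) (hnonneg i j)
  have hymax : IsMaxOn T.reApplyInnerSelf (Metric.sphere 0 ‖y‖) y := by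
    intro z hz
    rw [hy1] at hz
    exact (hmax hz).trans hxy
  have hy0 : y ≠ 0 := by
    rintro h
    simp [h] at hy1
  obtain ⟨lam, hlam⟩ : ∃ lam : ℝ, T y = lam • y :=
    ⟨_, Module.End.mem_eigenspace_iff.mp (hT.hasEigenvector_of_isMaxOn hy0 hymax).1⟩
  have heq (i : n) : ∑ j, A i j * y j = lam * y i := by
    have := congrArg (fun z : EuclideanSpace ℝ n ↦ z i) hlam
    simpa [hTdef, Matrix.ofLp_toEuclideanCLM, Matrix.mulVec, dotProduct] using this
  refine ⟨lam, y, fun i ↦ ?_, heq⟩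
  refine (abs_nonneg (x i)).lt_of_ne' fun hi ↦ hy0 ?_
  ext j
  -- The zero set of y is closed under neighbours, since at a zero the eigenvalue equation is a
  -- vanishing sum of nonnegative terms. By connectedness a single zero would force y = 0.
  refine hconn (fun j ↦ y j = 0) i j hi fun k l hk hkl ↦ ?_
  have hsum : ∑ j, A k j * y j = 0 := by rw [heq, hk, mul_zero]
  have := (Finset.sum_eq_zero_iff_of_nonneg fun j _ ↦
    mul_nonneg (hnonneg k j) (abs_nonneg (x j))).mp hsum l (Finset.mem_univ l)
  rw [hA.apply] at hkl
  exact (mul_eq_zero.mp this).resolve_left hkl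

end Perron

/-! ### The involutions τ₁, τ₂ and the positive roots that σ makes negative. -/

namespace SimplePartition

variable {ι M N : Type*} [AddCommGroup M] [Module ℂ M]
  [AddCommGroup N] [Module ℂ N] {P : RootPairing ι ℂ M N} {b : P.Base} (c : SimplePartition b)

lemma I₁_subset : c.I₁ ⊆ b.support := fun i hi ↦ (c.mem_support_iff i).mpr (.inl hi)

lemma I₂_subset : c.I₂ ⊆ b.support := fun i hi ↦ (c.mem_support_iff i).mpr (.inr hi)

lemma notMem_I₁ {i : ι} (hi : i ∈ c.I₂) : i ∉ c.I₁ := fun h ↦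
  Finset.disjoint_left.mp c.disjoint h hi

lemma notMem_I₂ {i : ι} (hi : i ∈ c.I₁) : i ∉ c.I₂ := fun h ↦
  Finset.disjoint_left.mp c.disjoint hi h

lemma τ₁_τ₁ (x : M) : c.τ₁ (c.τ₁ x) = x := reflectionProd_reflectionProd _ _ x

lemma τ₁_root {i : ι} (hi : i ∈ c.I₁) : c.τ₁ (P.root i) = -P.root i :=
  reflectionProd_root_of_mem _ hi

lemma τ₂_root {i : ι} (hi : i ∈ c.I₂) : c.τ₂ (P.root i) = -P.root i :=
  reflectionProd_root_of_mem _ hi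

lemma τ₁_mem_roots {φ : M} (hφ : φ ∈ roots P) : c.τ₁ φ ∈ roots P :=
  reflectionProd_mem_roots _ _ hφ

lemma τ₂_mem_roots {φ : M} (hφ : φ ∈ roots P) : c.τ₂ φ ∈ roots P :=
  reflectionProd_mem_roots _ _ hφ

lemma σ_apply (x : M) : c.σ x = c.τ₂ (c.τ₁ x) := rfl

lemma σ_mem_roots {φ : M} (hφ : φ ∈ roots P) : c.σ φ ∈ roots P :=
  c.τ₂_mem_roots (c.τ₁_mem_roots hφ)

lemma σ_pow_mem_roots {φ : M} (hφ : φ ∈ roots P) (k : ℕ) : (c.σ ^ k) φ ∈ roots P := by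
  induction k with
  | zero => exact hφ
  | succ k ih => rw [pow_succ']; exact c.σ_mem_roots ih

lemma σ_mem_closure : c.σ ∈ Submonoid.closure (P.reflection '' b.support) :=
  mul_mem (reflectionProd_mem_closure _ c.I₂_subset) (reflectionProd_mem_closure _ c.I₁_subset)

lemma β_eq_root {i : ι} (hi : i ∈ c.I₁) : c.β i = P.root i := if_pos hi

lemma β_eq_neg_root {i : ι} (hi : i ∈ c.I₂) : c.β i = -P.root i := if_neg (c.notMem_I₁ hi)

open Classical in
/-- The positive root in the `σ`-orbit of `β i` whose image under `σ` is negative. -/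
def start (i : ι) : M := if i ∈ c.I₁ then P.root i else c.τ₁ (P.root i)

lemma start_of_mem_I₁ {i : ι} (hi : i ∈ c.I₁) : c.start i = P.root i := if_pos hi

lemma start_of_mem_I₂ {i : ι} (hi : i ∈ c.I₂) : c.start i = c.τ₁ (P.root i) :=
  if_neg (c.notMem_I₁ hi)

lemma σ_start_of_mem_I₂ {i : ι} (hi : i ∈ c.I₂) : c.σ (c.start i) = c.β i := by
  rw [c.start_of_mem_I₂ hi, σ_apply, τ₁_τ₁, c.τ₂_root hi, c.β_eq_neg_root hi]

section Finite

variable [Finite ι] [P.IsCrystallographic] [P.IsReduced]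

lemma mem_I₁_of_τ₁_notMem {φ : M} (hφ : φ ∈ positiveRoots b) (h : c.τ₁ φ ∉ positiveRoots b) :
    ∃ i ∈ c.I₁, φ = P.root i :=
  exists_eq_root_of_reflectionProd_notMem _ c.I₁_subset hφ h

lemma mem_I₂_of_τ₂_notMem {φ : M} (hφ : φ ∈ positiveRoots b) (h : c.τ₂ φ ∉ positiveRoots b) :
    ∃ i ∈ c.I₂, φ = P.root i :=
  exists_eq_root_of_reflectionProd_notMem _ c.I₂_subset hφ h

lemma start_mem_positiveRoots {i : ι} (hi : i ∈ b.support) : c.start i ∈ positiveRoots b := by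
  rcases (c.mem_support_iff i).mp hi with h | h
  · rw [c.start_of_mem_I₁ h]
    exact root_mem_positiveRoots hi
  · rw [c.start_of_mem_I₂ h]
    by_contra hneg
    obtain ⟨j, hj, hij⟩ := c.mem_I₁_of_τ₁_notMem (root_mem_positiveRoots hi) hneg
    exact c.notMem_I₁ h (P.root.injective hij ▸ hj)

lemma σ_start_notMem {i : ι} (hi : i ∈ b.support) : c.σ (c.start i) ∉ positiveRoots b := by
  rcases (c.mem_support_iff i).mp hi with h | h
  · rw [c.start_of_mem_I₁ h, σ_apply, c.τ₁_root h, map_neg,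
      neg_mem_positiveRoots_iff (c.τ₂_mem_roots ⟨i, rfl⟩), not_not]
    by_contra hneg
    obtain ⟨j, hj, hij⟩ := c.mem_I₂_of_τ₂_notMem (root_mem_positiveRoots hi) hneg
    exact c.notMem_I₂ h (P.root.injective hij ▸ hj)
  · rw [c.σ_start_of_mem_I₂ h, c.β_eq_neg_root h, neg_mem_positiveRoots_iff ⟨i, rfl⟩, not_not]
    exact root_mem_positiveRoots hi

/-- The sign changes either under τ₁, and then φ lies in Π₁, or under τ₂, and then τ₁ φ lies in Π₂.
-/
lemma exists_eq_start {φ : M} (hφ : φ ∈ positiveRoots b) (h : c.σ φ ∉ positiveRoots b) :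
    ∃ i ∈ b.support, φ = c.start i := by
  by_cases h₁ : c.τ₁ φ ∈ positiveRoots b
  · obtain ⟨j, hj, hφj⟩ := c.mem_I₂_of_τ₂_notMem h₁ h
    exact ⟨j, c.I₂_subset hj, by rw [c.start_of_mem_I₂ hj, ← hφj, τ₁_τ₁]⟩
  · obtain ⟨j, hj, rfl⟩ := c.mem_I₁_of_τ₁_notMem hφ h₁
    exact ⟨j, c.I₁_subset hj, (c.start_of_mem_I₁ hj).symm⟩

end Finite

lemma start_injOn {i j : ι} (hi : i ∈ b.support) (hj : j ∈ b.support)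
    (h : c.start i = c.start j) : i = j := by
  have key {i j : ι} (hi : i ∈ c.I₁) (hj : j ∈ c.I₂) : c.start i ≠ c.start j := by
    intro h
    have h' : c.τ₁ (c.start i) = P.root j := by rw [h, c.start_of_mem_I₂ hj, τ₁_τ₁]
    rw [c.start_of_mem_I₁ hi, c.τ₁_root hi] at h'
    have hneg : -P.root i ∈ positiveRoots b := h' ▸ root_mem_positiveRoots (c.I₂_subset hj)
    exact (neg_mem_positiveRoots_iff ⟨i, rfl⟩).mp hneg (root_mem_positiveRoots (c.I₁_subset hi))
  rcases (c.mem_support_iff i).mp hi with hi | hi <;>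
    rcases (c.mem_support_iff j).mp hj with hj | hj
  · rw [c.start_of_mem_I₁ hi, c.start_of_mem_I₁ hj] at h
    exact P.root.injective h
  · exact absurd h (key hi hj)
  · exact absurd h.symm (key hj hi)
  · rw [c.start_of_mem_I₂ hi, c.start_of_mem_I₂ hj] at h
    exact P.root.injective (c.τ₁.injective h)

end SimplePartition

end CoxeterOrbit

/-! ### Construction of the Coxeter plane. -/

namespace CoxeterOrbit

variable {ι M N : Type*} [AddCommGroup M] [Module ℂ M]
  [AddCommGroup N] [Module ℂ N] {P : RootPairing ι ℂ M N} {b : P.Base}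

/-- Two additive functionals, positive on the simple roots of `Π₁` (respectively `Π₂`) and zero on
the other simple roots, which span a plane that is stable under `τ₁` and `τ₂`. -/
structure CoxeterPlane (c : SimplePartition b) where
  /-- The functional which is supported on `Π₁`. -/
  D₁ : M →+ ℝ
  /-- The functional which is supported on `Π₂`. -/
  D₂ : M →+ ℝ
  /-- The largest eigenvalue of the adjacency matrix of the Dynkin diagram. -/
  lam : ℝ
  D₁_pos : ∀ i ∈ c.I₁, 0 < D₁ (P.root i)
  D₁_zero : ∀ i ∈ c.I₂, D₁ (P.root i) = 0
  D₂_pos : ∀ i ∈ c.I₂, 0 < D₂ (P.root i)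
  D₂_zero : ∀ i ∈ c.I₁, D₂ (P.root i) = 0
  D₁_τ₁ : ∀ x, D₁ (c.τ₁ x) = -D₁ x + lam * D₂ x
  D₂_τ₁ : ∀ x, D₂ (c.τ₁ x) = D₂ x
  D₁_τ₂ : ∀ x, D₁ (c.τ₂ x) = D₁ x
  D₂_τ₂ : ∀ x, D₂ (c.τ₂ x) = -D₂ x + lam * D₁ x
  lam_nonneg : 0 ≤ lam
  lam_lt_two : lam < 2
  lam_eq_zero : c.I₁ = ∅ ∨ c.I₂ = ∅ → lam = 0

lemma pairing_eq_pairingIn [P.IsCrystallographic] (i j : ι) :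
    P.pairing i j = (P.pairingIn ℤ i j : ℂ) := by
  rw [← P.algebraMap_pairingIn ℤ]
  simp

section Functional

variable {s t : Finset ι}
  (hs : (s : Set ι).Pairwise P.IsOrthogonal) (hst : Disjoint s t)
  (hb : ∀ i, i ∈ b.support ↔ i ∈ s ∨ i ∈ t) {L L' : M →ₗ[ℂ] ℂ}

include hst hb in
-- Checked on simple roots. For j in t, orthogonality inside t leaves only the diagonal term and the
-- terms from s in the eigenvalue equation at j, so the sum over s equals -lam * d j.
lemma functional_reflectionProd [P.IsRootSystem] [P.IsCrystallographic] {d : ι → ℝ} {lam : ℝ}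
    (hd : ∀ j ∈ b.support, ∑ i ∈ b.support, (P.pairingIn ℤ j i : ℝ) * d i = (2 - lam) * d j)
    (hL : ∀ i ∈ s, L (P.root i) = d i) (hL₀ : ∀ i ∈ t, L (P.root i) = 0)
    (hL' : ∀ i ∈ t, L' (P.root i) = d i) (hL'₀ : ∀ i ∈ s, L' (P.root i) = 0)
    (ht : (t : Set ι).Pairwise P.IsOrthogonal) (x : M) :
    L (reflectionProd P s hs x) = -L x + lam * L' x := by
  classical
  suffices L ∘ₗ (reflectionProd P s hs : M →ₗ[ℂ] M) = -L + (lam : ℂ) • L' from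
    LinearMap.congr_fun this x
  refine b.toWeightBasis.ext fun ⟨j, hj⟩ ↦ ?_
  simp only [RootPairing.Base.toWeightBasis_apply, LinearMap.comp_apply, LinearEquiv.coe_coe,
    LinearMap.add_apply, LinearMap.neg_apply, LinearMap.smul_apply, smul_eq_mul]
  rcases (hb j).mp hj with h | h
  · rw [reflectionProd_root_of_mem hs h, map_neg, hL'₀ j h]
    ring
  · rw [reflectionProd_apply, map_sub, map_sum, hL₀ j h, hL' j h]
    have hu : b.support = s ∪ t := by
      ext i
      simp [hb]
    have h₁ := hd j hj
    rw [hu, Finset.sum_union hst, Finset.sum_eq_single_of_mem j h] at h₁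
    · have h₂ : ∑ i ∈ s, L (P.coroot' i (P.root j) • P.root i)
          = ((∑ i ∈ s, (P.pairingIn ℤ j i : ℝ) * d i : ℝ) : ℂ) := by
        push_cast
        refine Finset.sum_congr rfl fun i hi ↦ ?_
        rw [map_smul, P.root_coroot'_eq_pairing, pairing_eq_pairingIn, hL i hi, smul_eq_mul]
      have h₃ : ∑ i ∈ s, (P.pairingIn ℤ j i : ℝ) * d i = -lam * d j := by
        simp only [P.pairingIn_same] at h₁
        push_cast at h₁
        linarith
      rw [h₂, h₃]
      push_cast
      ring
    · intro i hi hne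
      have := (ht h hi hne.symm).1
      rw [pairing_eq_pairingIn] at this
      norm_cast at this
      simp [this]

lemma functional_reflectionProd_of_forall_eq_zero (hL₀ : ∀ i ∈ s, L (P.root i) = 0) (x : M) :
    L (reflectionProd P s hs x) = L x := by
  rw [reflectionProd_apply, map_sub, map_sum, Finset.sum_eq_zero, sub_zero]
  intro i hi
  rw [map_smul, hL₀ i hi, smul_zero]

end Functional

section Existence

variable [Finite ι] [P.IsCrystallographic] [P.IsIrreducible]

/-- The eigenvalue of a positive eigenvector of the adjacency matrix is less than `2`: evaluate at a
root at which the corresponding functional is maximal. -/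
lemma eigenvalue_lt_two [Nonempty ι] {d : ι → ℝ} {lam : ℝ} (hdpos : ∀ i ∈ b.support, 0 < d i)
    (hd : ∀ j ∈ b.support, ∑ i ∈ b.support, (P.pairingIn ℤ j i : ℝ) * d i = (2 - lam) * d j) :
    lam < 2 := by
  classical
  set L : M →ₗ[ℂ] ℂ := b.toWeightBasis.constr ℂ fun i ↦ (d i : ℂ) with hLdef
  have hL (i : ι) (hi : i ∈ b.support) : L (P.root i) = d i := by
    have := b.toWeightBasis.constr_basis ℂ (fun i ↦ (d i : ℂ)) ⟨i, hi⟩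
    rwa [b.toWeightBasis_apply] at this
  have hsum (x : M) : ∑ i ∈ b.support, P.coroot' i x * d i = (2 - lam) * L x := by
    suffices ∑ i ∈ b.support, (d i : ℂ) • P.coroot' i = (2 - lam : ℂ) • L by
      simpa [mul_comm] using LinearMap.congr_fun this x
    refine b.toWeightBasis.ext fun ⟨j, hj⟩ ↦ ?_
    have := congrArg (fun r : ℝ ↦ (r : ℂ)) (hd j hj)
    push_cast at this
    simpa [hL j hj, pairing_eq_pairingIn, mul_comm] using this
  -- A root maximising L is dominant, because simple reflections cannot increase L. If lam ≥ 2, its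
  -- nonnegative pairings with the simple roots would all have to vanish.
  obtain ⟨k, hk⟩ := Finite.exists_max fun k ↦ (L (P.root k)).re
  have hpair (i : ι) (hi : i ∈ b.support) : 0 ≤ P.pairingIn ℤ k i := by
    have h₁ := hk (P.reflectionPerm i k)
    rw [P.root_reflectionPerm, P.reflection_apply_root, map_sub, map_smul, hL i hi,
      pairing_eq_pairingIn] at h₁
    have h₂ : (0 : ℝ) ≤ P.pairingIn ℤ k i * d i := by simpa using h₁
    exact_mod_cast nonneg_of_mul_nonneg_left h₂ (hdpos i hi)
  have hpos : 0 < (L (P.root k)).re := by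
    obtain ⟨i, hi⟩ := b.support_nonempty
    refine lt_of_lt_of_le ?_ (hk i)
    simpa [hL i hi] using hdpos i hi
  have hre : ∑ i ∈ b.support, (P.pairingIn ℤ k i : ℝ) * d i = (2 - lam) * (L (P.root k)).re := by
    have := congrArg Complex.re (hsum (P.root k))
    simpa [pairing_eq_pairingIn] using this
  by_contra! hlam
  have hle : ∑ i ∈ b.support, (P.pairingIn ℤ k i : ℝ) * d i ≤ 0 :=
    hre ▸ mul_nonpos_of_nonpos_of_nonneg (by linarith) hpos.le
  have hnn (i : ι) (hi : i ∈ b.support) : (0 : ℝ) ≤ P.pairingIn ℤ k i * d i :=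
    mul_nonneg (by exact_mod_cast hpair i hi) (hdpos i hi).le
  obtain ⟨i, hi, hne⟩ := b.exists_mem_support_pos_pairingIn_ne_zero k
  have h₀ := (Finset.sum_eq_zero_iff_of_nonneg hnn).mp
    (le_antisymm hle (Finset.sum_nonneg hnn)) i hi
  rcases mul_eq_zero.mp h₀ with h | h
  · exact hne (P.pairingIn_eq_zero_iff.mp (by exact_mod_cast h))
  · exact (hdpos i hi).ne' h

lemma exists_pos_eigenvector_of_cartanMatrix_symm [P.IsReduced] [Nonempty ι]
    (hsymm : ∀ i j, b.cartanMatrix i j = b.cartanMatrix j i) :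
    ∃ (lam : ℝ) (d : ι → ℝ), (∀ i ∈ b.support, 0 < d i) ∧
      ∀ j ∈ b.support, ∑ i ∈ b.support, (P.pairingIn ℤ j i : ℝ) * d i = (2 - lam) * d j := by
  classical
  have : Nonempty b.support := b.support_nonempty.to_subtype
  -- The adjacency matrix 2 - C of the Dynkin diagram; irreducibility supplies the connectedness,
  -- through `induction_on_cartanMatrix`.
  let A : Matrix b.support b.support ℝ := fun i j ↦ (if i = j then 2 else 0) - b.cartanMatrix i j
  obtain ⟨lam, d, hd, heq⟩ := exists_pos_eigenvector (A := A)
    (Matrix.IsSymm.ext fun i j ↦ by simp only [A, eq_comm (a := i), hsymm i j])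
    (fun i j ↦ by
      by_cases h : i = j
      · simp [A, h]
      · simpa [A, h] using b.cartanMatrix_le_zero_of_ne i j h)
    (fun p i j hi hp ↦ b.induction_on_cartanMatrix p hi fun k l hk hkl ↦ by
      by_cases h : l = k
      · exact h ▸ hk
      · exact hp k l hk (by simpa [A, h] using hkl))
  refine ⟨lam, fun i ↦ if h : i ∈ b.support then d ⟨i, h⟩ else 0, fun i hi ↦ ?_, fun j hj ↦ ?_⟩
  · simpa [hi] using hd ⟨i, hi⟩
  · have h := heq ⟨j, hj⟩
    rw [← Finset.sum_coe_sort]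
    simp only [A, sub_mul, ite_mul, zero_mul, Finset.sum_sub_distrib, Finset.sum_ite_eq,
      Finset.mem_univ, if_true] at h
    simp only [Finset.coe_mem, dite_true, hj]
    have h' : ∀ i : b.support, (P.pairingIn ℤ j i : ℝ) = b.cartanMatrix ⟨j, hj⟩ i := fun _ ↦ rfl
    simp only [h', Subtype.coe_eta]
    linarith

/-- A Coxeter plane exists if the Cartan matrix is symmetric. -/
lemma nonempty_coxeterPlane [P.IsReduced] [Nonempty ι] (c : SimplePartition b)
    (hsymm : ∀ i j, b.cartanMatrix i j = b.cartanMatrix j i) : Nonempty (CoxeterPlane c) := by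
  classical
  obtain ⟨lam, d, hdpos, hd⟩ := exists_pos_eigenvector_of_cartanMatrix_symm hsymm
  -- The functionals are built complex linear, to be compared on a basis; only real parts are kept,
  -- which loses nothing on roots since d is real.
  let L (s : Finset ι) : M →ₗ[ℂ] ℂ := b.toWeightBasis.constr ℂ fun i ↦
    if (i : ι) ∈ s then (d i : ℂ) else 0
  have hL (s : Finset ι) (i : ι) (hi : i ∈ b.support) :
      L s (P.root i) = if i ∈ s then (d i : ℂ) else 0 := by
    have := b.toWeightBasis.constr_basis ℂ (fun i ↦ if (i : ι) ∈ s then (d i : ℂ) else 0) ⟨i, hi⟩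
    rwa [b.toWeightBasis_apply] at this
  have h₁ (i : ι) (hi : i ∈ c.I₁) : L c.I₁ (P.root i) = d i := by
    rw [hL _ i (c.I₁_subset hi), if_pos hi]
  have h₁₀ (i : ι) (hi : i ∈ c.I₂) : L c.I₁ (P.root i) = 0 := by
    rw [hL _ i (c.I₂_subset hi), if_neg (c.notMem_I₁ hi)]
  have h₂ (i : ι) (hi : i ∈ c.I₂) : L c.I₂ (P.root i) = d i := by
    rw [hL _ i (c.I₂_subset hi), if_pos hi]
  have h₂₀ (i : ι) (hi : i ∈ c.I₁) : L c.I₂ (P.root i) = 0 := by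
    rw [hL _ i (c.I₁_subset hi), if_neg (c.notMem_I₂ hi)]
  have hdiag (i j : ι) (s : Finset ι) (hs : (s : Set ι).Pairwise P.IsOrthogonal) (hi : i ∈ s)
      (hj : j ∈ s) (hij : j ≠ i) : P.pairingIn ℤ i j = 0 := by
    have := (hs hi hj hij.symm).1
    rw [pairing_eq_pairingIn] at this
    exact_mod_cast this
  have hnonneg : 0 ≤ lam := by
    obtain ⟨j, hj⟩ := b.support_nonempty
    have h := hd j hj
    rw [← Finset.add_sum_erase _ _ hj, P.pairingIn_same] at h
    have hle : ∑ i ∈ b.support.erase j, (P.pairingIn ℤ j i : ℝ) * d i ≤ 0 := by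
      refine Finset.sum_nonpos fun i hi ↦ ?_
      obtain ⟨hne, hi⟩ := Finset.mem_erase.mp hi
      refine mul_nonpos_of_nonpos_of_nonneg ?_ (hdpos i hi).le
      exact_mod_cast b.cartanMatrix_le_zero_of_ne ⟨j, hj⟩ ⟨i, hi⟩ (by simpa using hne.symm)
    push_cast at h
    exact nonneg_of_mul_nonneg_left (by linarith) (hdpos j hj)
  have hzero (s : Finset ι) (hs : (s : Set ι).Pairwise P.IsOrthogonal)
      (hbs : ∀ i, i ∈ b.support → i ∈ s) : lam = 0 := by
    obtain ⟨j, hj⟩ := b.support_nonempty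
    have h := hd j hj
    rw [Finset.sum_eq_single_of_mem j hj fun i hi hne ↦ by
      rw [hdiag j i s hs (hbs j hj) (hbs i hi) hne, Int.cast_zero, zero_mul], P.pairingIn_same] at h
    push_cast at h
    have : lam * d j = 0 := by linarith
    exact (mul_eq_zero.mp this).resolve_right (hdpos j hj).ne'
  have hre (x y z : M) (s t u : Finset ι) (h : L s x = -L t y + lam * L u z) :
      (L s x).re = -(L t y).re + lam * (L u z).re := by
    rw [h]
    simp
  exact ⟨{
    D₁ := Complex.reAddGroupHom.comp (L c.I₁).toAddMonoidHom
    D₂ := Complex.reAddGroupHom.comp (L c.I₂).toAddMonoidHom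
    lam := lam
    D₁_pos := fun i hi ↦ by simpa [h₁ i hi] using hdpos i (c.I₁_subset hi)
    D₁_zero := fun i hi ↦ by simp [h₁₀ i hi]
    D₂_pos := fun i hi ↦ by simpa [h₂ i hi] using hdpos i (c.I₂_subset hi)
    D₂_zero := fun i hi ↦ by simp [h₂₀ i hi]
    D₁_τ₁ := fun x ↦ hre _ _ _ _ _ _ <| functional_reflectionProd c.orthogonal₁ c.disjoint
      c.mem_support_iff hd h₁ h₁₀ h₂ h₂₀ c.orthogonal₂ x
    D₂_τ₁ := fun x ↦ congrArg Complex.re <|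
      functional_reflectionProd_of_forall_eq_zero c.orthogonal₁ h₂₀ x
    D₁_τ₂ := fun x ↦ congrArg Complex.re <|
      functional_reflectionProd_of_forall_eq_zero c.orthogonal₂ h₁₀ x
    D₂_τ₂ := fun x ↦ hre _ _ _ _ _ _ <| functional_reflectionProd c.orthogonal₂ c.disjoint.symm
      (fun i ↦ (c.mem_support_iff i).trans or_comm) hd h₂ h₂₀ h₁ h₁₀ c.orthogonal₁ x
    lam_nonneg := hnonneg
    lam_lt_two := eigenvalue_lt_two hdpos hd
    lam_eq_zero := fun h ↦ by
      rcases h with h | h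
      · exact hzero c.I₂ c.orthogonal₂ fun i hi ↦ by simpa [h] using (c.mem_support_iff i).mp hi
      · exact hzero c.I₁ c.orthogonal₁ fun i hi ↦ by simpa [h] using (c.mem_support_iff i).mp hi }⟩

end Existence

end CoxeterOrbit

/-! ### The rotation of the Coxeter plane by σ. -/

namespace CoxeterOrbit

variable {ι M N : Type*} [AddCommGroup M] [Module ℂ M]
  [AddCommGroup N] [Module ℂ N] {P : RootPairing ι ℂ M N} {b : P.Base}

namespace SimplePartition

variable (c : SimplePartition b)

lemma τ₂_τ₂ (x : M) : c.τ₂ (c.τ₂ x) = x := reflectionProd_reflectionProd _ _ x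

lemma σ_σ_inv (x : M) : c.σ (c.σ⁻¹ x) = x := c.σ.apply_symm_apply x

lemma σ_inv_apply (x : M) : c.σ⁻¹ x = c.τ₁ (c.τ₂ x) := by
  apply c.σ.injective
  rw [σ_σ_inv, σ_apply, τ₁_τ₁, τ₂_τ₂]

lemma σ_inv_pow_mem_roots {φ : M} (hφ : φ ∈ roots P) (k : ℕ) : (c.σ⁻¹ ^ k) φ ∈ roots P := by
  induction k with
  | zero => exact hφ
  | succ k ih =>
    rw [pow_succ', LinearEquiv.mul_apply, σ_inv_apply]
    exact c.τ₁_mem_roots (c.τ₂_mem_roots ih)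

lemma σ_pow_σ_inv_pow (k : ℕ) (x : M) : (c.σ ^ k) ((c.σ⁻¹ ^ k) x) = x := by
  rw [← LinearEquiv.mul_apply, inv_pow, mul_inv_cancel]
  rfl

lemma σ_inv_pow_σ_pow (k : ℕ) (x : M) : (c.σ⁻¹ ^ k) ((c.σ ^ k) x) = x := by
  rw [← LinearEquiv.mul_apply, inv_pow, inv_mul_cancel]
  rfl

open Classical in
/-- The colour of a simple root: `0` for `Π₁` and `1` for `Π₂`. -/
def color (i : ι) : ℕ := if i ∈ c.I₁ then 0 else 1

lemma color_of_mem_I₁ {i : ι} (hi : i ∈ c.I₁) : c.color i = 0 := if_pos hi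

lemma color_of_mem_I₂ {i : ι} (hi : i ∈ c.I₂) : c.color i = 1 := if_neg (c.notMem_I₁ hi)

/-- Allows both colours to be treated by one formula: the colour is the number of σ-steps from
`start i` to β_i. -/
lemma β_eq_σ_pow_start {i : ι} (hi : i ∈ b.support) :
    c.β i = (c.σ ^ c.color i) (c.start i) := by
  rcases (c.mem_support_iff i).mp hi with h | h
  · rw [c.color_of_mem_I₁ h, c.start_of_mem_I₁ h, c.β_eq_root h]
    rfl
  · rw [c.color_of_mem_I₂ h, pow_one, c.σ_start_of_mem_I₂ h]

lemma color_le_one (i : ι) : c.color i ≤ 1 := by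
  unfold color
  split_ifs <;> simp

end SimplePartition

namespace CoxeterPlane

variable {c : SimplePartition b} (p : CoxeterPlane c)

/-- The angle `θ` such that `lam = 2 cos θ`. -/
def angle : ℝ := Real.arccos (p.lam / 2)

lemma two_mul_cos_angle : 2 * Real.cos p.angle = p.lam := by
  rw [angle, Real.cos_arccos] <;> linarith [p.lam_nonneg, p.lam_lt_two]

lemma angle_pos : 0 < p.angle := Real.arccos_pos.mpr (by linarith [p.lam_lt_two])

lemma angle_le : p.angle ≤ Real.pi / 2 :=
  Real.arccos_le_pi_div_two.mpr (by linarith [p.lam_nonneg])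

lemma sin_recurrence (t : ℝ) : p.lam * Real.sin (t * p.angle) =
    Real.sin ((t + 1) * p.angle) + Real.sin ((t - 1) * p.angle) := by
  rw [← p.two_mul_cos_angle, add_mul, sub_mul, one_mul, Real.sin_add, Real.sin_sub]
  ring

/-- The functional of phase `t` on the Coxeter plane, which `σ` rotates. -/
def G (t : ℝ) : M →+ ℝ :=
  Real.sin (t * p.angle) • p.D₁ - Real.sin ((t - 1) * p.angle) • p.D₂

lemma G_apply (t : ℝ) (x : M) :
    p.G t x = Real.sin (t * p.angle) * p.D₁ x - Real.sin ((t - 1) * p.angle) * p.D₂ x := rfl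

/-- Two uses of the sine recurrence, one for each of τ₁ and τ₂; each accounts for a phase shift by
one. -/
lemma G_σ (t : ℝ) (x : M) : p.G t (c.σ x) = p.G (t - 2) x := by
  have h₁ := p.sin_recurrence (t - 1)
  have h₂ := p.sin_recurrence (t - 2)
  rw [show t - 1 + 1 = t by ring, show t - 1 - 1 = t - 2 by ring] at h₁
  rw [show t - 2 + 1 = t - 1 by ring, show t - 2 - 1 = t - 3 by ring] at h₂
  rw [G_apply, G_apply, c.σ_apply, p.D₁_τ₂, p.D₂_τ₂, p.D₁_τ₁, p.D₂_τ₁,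
    show t - 2 - 1 = t - 3 by ring]
  linear_combination (p.D₁ x - p.lam * p.D₂ x) * h₁ - p.D₂ x * h₂

lemma G_σ_pow (t : ℝ) (k : ℕ) (x : M) : p.G t ((c.σ ^ k) x) = p.G (t - 2 * k) x := by
  induction k generalizing t with
  | zero => simp
  | succ k ih =>
    rw [pow_succ', LinearEquiv.mul_apply, G_σ, ih]
    push_cast
    ring_nf

lemma G_σ_inv_pow (t : ℝ) (k : ℕ) (x : M) : p.G t ((c.σ⁻¹ ^ k) x) = p.G (t + 2 * k) x := by
  rw [show t = t + 2 * k - 2 * k by ring, ← G_σ_pow, c.σ_pow_σ_inv_pow]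
  ring_nf

/-- The positive coefficient of a simple root in the Coxeter plane. -/
def weight (i : ι) : ℝ := p.D₁ (P.root i) + p.D₂ (P.root i)

lemma weight_pos {i : ι} (hi : i ∈ b.support) : 0 < p.weight i := by
  rcases (c.mem_support_iff i).mp hi with h | h
  · simpa [weight, p.D₂_zero i h] using p.D₁_pos i h
  · simpa [weight, p.D₁_zero i h] using p.D₂_pos i h

/-- For i in Π₂ the start is τ₁ α_i, and the recurrence turns lam sin(tθ) - sin((t - 1)θ) into
sin((t + 1)θ); hence the colour enters as a phase. -/
lemma G_start {i : ι} (hi : i ∈ b.support) (t : ℝ) :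
    p.G t (c.start i) = p.weight i * Real.sin ((t + c.color i) * p.angle) := by
  rcases (c.mem_support_iff i).mp hi with h | h
  · rw [c.start_of_mem_I₁ h, c.color_of_mem_I₁ h, G_apply, weight, p.D₂_zero i h]
    simp [mul_comm]
  · rw [c.start_of_mem_I₂ h, c.color_of_mem_I₂ h, G_apply, weight, p.D₁_τ₁, p.D₂_τ₁,
      p.D₁_zero i h, Nat.cast_one]
    linear_combination p.D₂ (P.root i) * p.sin_recurrence t

lemma G_σ_inv_pow_start {i : ι} (hi : i ∈ b.support) (k : ℕ) (t : ℝ) :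
    p.G t ((c.σ⁻¹ ^ k) (c.start i)) =
      p.weight i * Real.sin ((t + (2 * k + c.color i : ℕ)) * p.angle) := by
  rw [G_σ_inv_pow, p.G_start hi]
  push_cast
  ring_nf

/-- In this range both sin(tθ) and -sin((t - 1)θ) are positive, so `G t` is positive on every simple
root. -/
lemma G_pos {t : ℝ} (ht₀ : 0 < t) (ht₁ : t < 1) {φ : M} (hφ : φ ∈ positiveRoots b) :
    0 < p.G t φ := by
  have hθ := p.angle_pos
  have hπ := p.angle_le
  have h₁ : 0 < Real.sin (t * p.angle) :=
    Real.sin_pos_of_pos_of_lt_pi (by positivity) (by nlinarith [Real.pi_pos])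
  have h₂ : Real.sin ((t - 1) * p.angle) < 0 :=
    Real.sin_neg_of_neg_of_neg_pi_lt (by nlinarith) (by nlinarith [Real.pi_pos])
  refine map_pos_of_mem_positiveRoots _ (fun i hi ↦ ?_) hφ
  rw [G_apply]
  rcases (c.mem_support_iff i).mp hi with h | h
  · rw [p.D₂_zero i h]
    nlinarith [p.D₁_pos i h]
  · rw [p.D₁_zero i h]
    nlinarith [p.D₂_pos i h]

lemma G_pos_iff {t : ℝ} (ht₀ : 0 < t) (ht₁ : t < 1) {φ : M} (hφ : φ ∈ roots P) :
    0 < p.G t φ ↔ φ ∈ positiveRoots b := by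
  refine ⟨fun h ↦ ?_, p.G_pos ht₀ ht₁⟩
  by_contra hneg
  have := p.G_pos ht₀ ht₁ ((neg_mem_positiveRoots_iff hφ).mpr hneg)
  rw [map_neg] at this
  linarith

lemma G_ne_zero {t : ℝ} (ht₀ : 0 < t) (ht₁ : t < 1) {φ : M} (hφ : φ ∈ roots P) :
    p.G t φ ≠ 0 := by
  intro h
  by_cases hpos : φ ∈ positiveRoots b
  · exact (p.G_pos ht₀ ht₁ hpos).ne' h
  · have := p.G_pos ht₀ ht₁ ((neg_mem_positiveRoots_iff hφ).mpr hpos)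
    rw [map_neg, h] at this
    simp at this

lemma G_add_two_mul {m : ℕ} (hm : m * p.angle = Real.pi) (t : ℝ) :
    p.G (t + 2 * m) = p.G t := by
  ext x
  have h (s : ℝ) : Real.sin ((s + 2 * m) * p.angle) = Real.sin (s * p.angle) := by
    rw [← Real.sin_add_two_pi (s * p.angle), ← hm]
    ring_nf
  rw [G_apply, G_apply, h, show t + 2 * m - 1 = t - 1 + 2 * m by ring, h]

lemma D₁_add_D₂_pos {φ : M} (hφ : φ ∈ positiveRoots b) : 0 < (p.D₁ + p.D₂) φ :=
  map_pos_of_mem_positiveRoots _ (fun _ hi ↦ p.weight_pos hi) hφ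

/-! ### Runs of positive roots along the orbits of σ. -/

section Finite

variable [Finite ι] [P.IsCrystallographic] [P.IsReduced]

/-- The angle is an integral fraction of `π`. -/
lemma exists_mul_angle_eq_pi : ∃ m : ℕ, 2 ≤ m ∧ m * p.angle = Real.pi := by
  have hθ := p.angle_pos
  -- This case absorbs an empty part, so that roots of both colours are available afterwards.
  by_cases hlam : p.lam = 0
  · refine ⟨2, le_rfl, ?_⟩
    rw [angle, hlam, zero_div, Real.arccos_zero]
    push_cast
    ring
  have h₁ : c.I₁.Nonempty := Finset.nonempty_iff_ne_empty.mpr fun h ↦ hlam (p.lam_eq_zero (.inl h))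
  have h₂ : c.I₂.Nonempty := Finset.nonempty_iff_ne_empty.mpr fun h ↦ hlam (p.lam_eq_zero (.inr h))
  set m := ⌊Real.pi / p.angle⌋₊ with hm
  have hle : (m : ℝ) ≤ Real.pi / p.angle := Nat.floor_le (by positivity)
  have hlt : Real.pi / p.angle < m + 1 := Nat.lt_floor_add_one _
  refine ⟨m, Nat.le_floor ?_, ?_⟩
  · rw [le_div_iff₀ hθ]
    push_cast
    linarith [p.angle_le]
  by_contra hne
  have hmlt : (m : ℝ) < Real.pi / p.angle :=
    lt_of_le_of_ne hle fun h ↦ hne (by rw [h]; field_simp)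
  -- If π/θ is not an integer, t = π/θ - m lies in (0, 1). Choosing the colour by the parity of m
  -- gives a root of phase exactly t + m, on which `G t` is a multiple of sin π = 0.
  obtain ⟨i, hi, k, hk⟩ : ∃ i ∈ b.support, ∃ k, m = 2 * k + c.color i := by
    rcases Nat.even_or_odd' m with ⟨k, hk | hk⟩
    · obtain ⟨i, hi⟩ := h₁
      exact ⟨i, c.I₁_subset hi, k, by rw [c.color_of_mem_I₁ hi, hk, add_zero]⟩
    · obtain ⟨i, hi⟩ := h₂
      exact ⟨i, c.I₂_subset hi, k, by rw [c.color_of_mem_I₂ hi, hk]⟩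
  refine p.G_ne_zero (t := Real.pi / p.angle - m) (by linarith) (by linarith)
    (c.σ_inv_pow_mem_roots (c.start_mem_positiveRoots hi).1 k) ?_
  rw [p.G_σ_inv_pow_start hi, ← hk, sub_add_cancel, div_mul_cancel₀ _ hθ.ne', Real.sin_pi, mul_zero]

variable {m : ℕ} (hm₂ : 2 ≤ m) (hm : m * p.angle = Real.pi)

include hm in
-- With n = 2k + ε, the sign is that of sin((n + 1/2)π/m): positive on the half-turn n < m, and
-- negative for m ≤ n < 2m, which is the next lemma.
lemma σ_inv_pow_start_mem {i : ι} (hi : i ∈ b.support) {k : ℕ} (hk : 2 * k + c.color i < m) :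
    (c.σ⁻¹ ^ k) (c.start i) ∈ positiveRoots b := by
  rw [← p.G_pos_iff (t := 1 / 2) (by norm_num) (by norm_num)
    (c.σ_inv_pow_mem_roots (c.start_mem_positiveRoots hi).1 k), p.G_σ_inv_pow_start hi]
  have hθ := p.angle_pos
  have hk' : ((2 * k + c.color i : ℕ) : ℝ) + 1 ≤ m := by exact_mod_cast hk
  refine mul_pos (p.weight_pos hi) (Real.sin_pos_of_pos_of_lt_pi (by positivity) ?_)
  rw [← hm]
  exact mul_lt_mul_of_pos_right (by linarith) hθ

include hm in
lemma σ_inv_pow_start_notMem {i : ι} (hi : i ∈ b.support) {k : ℕ} (hk : m ≤ 2 * k + c.color i)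
    (hk' : 2 * k + c.color i < 2 * m) : (c.σ⁻¹ ^ k) (c.start i) ∉ positiveRoots b := by
  rw [← p.G_pos_iff (t := 1 / 2) (by norm_num) (by norm_num)
    (c.σ_inv_pow_mem_roots (c.start_mem_positiveRoots hi).1 k), p.G_σ_inv_pow_start hi, not_lt]
  have hθ := p.angle_pos
  have h₁ : (m : ℝ) ≤ (2 * k + c.color i : ℕ) := by exact_mod_cast hk
  have h₂ : ((2 * k + c.color i : ℕ) : ℝ) + 1 ≤ 2 * m := by exact_mod_cast hk'
  refine mul_nonpos_of_nonneg_of_nonpos (p.weight_pos hi).le ?_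
  rw [← neg_nonneg, ← Real.sin_sub_pi]
  refine Real.sin_nonneg_of_nonneg_of_le_pi ?_ ?_ <;> rw [← hm] <;> nlinarith

include hm in
-- σ^m shifts the phase by a full turn, so it preserves the values of `G t` and with them the
-- positive roots; a product of simple reflections doing so is trivial.
lemma σ_pow_eq_one : c.σ ^ m = 1 := by
  refine eq_one_of_mem_closure_of_mapsTo (b := b) (pow_mem c.σ_mem_closure m) fun φ hφ ↦ ?_
  rw [← p.G_pos_iff (t := 1 / 2) (by norm_num) (by norm_num) (c.σ_pow_mem_roots hφ.1 m),
    G_σ_pow, ← p.G_add_two_mul hm, sub_add_cancel]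
  exact p.G_pos (by norm_num) (by norm_num) hφ

include hm hm₂ in
/-- No root stays positive under all powers of `σ`, since `σ` has no fixed vector in the Coxeter
plane. -/
lemma exists_σ_pow_notMem (φ : M) : ∃ k, (c.σ ^ k) φ ∉ positiveRoots b := by
  by_contra! hpos
  set S := ∑ k ∈ Finset.range m, (c.σ ^ k) φ with hS
  have hfix : c.σ S = S := by
    have h₁ : c.σ S = ∑ k ∈ Finset.range m, (c.σ ^ (k + 1)) φ := by
      rw [hS, map_sum]
      exact Finset.sum_congr rfl fun k _ ↦ by rw [pow_succ', LinearEquiv.mul_apply]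
    have h₂ := Finset.sum_range_succ (fun k ↦ (c.σ ^ k) φ) m
    rw [Finset.sum_range_succ', p.σ_pow_eq_one hm, pow_zero] at h₂
    rw [h₁]
    exact add_right_cancel h₂
  have hS₀ : 0 < (p.D₁ + p.D₂) S := by
    rw [hS, map_sum]
    refine Finset.sum_pos (fun k _ ↦ p.D₁_add_D₂_pos (hpos k)) ?_
    simp
    lia
  -- Invariance of S gives 2 D₁ = lam D₂ and 2 D₂ = lam D₁ at S, so (2 - lam)(D₁ + D₂) vanishes
  -- there, against lam < 2.
  have h₁ := p.D₁_τ₂ (c.τ₁ S)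
  have h₂ := p.D₂_τ₂ (c.τ₁ S)
  rw [← c.σ_apply, hfix, p.D₁_τ₁] at h₁ h₂
  rw [p.D₂_τ₁] at h₂
  rw [AddMonoidHom.add_apply] at hS₀
  nlinarith [p.lam_lt_two, p.lam_nonneg]

include hm hm₂ in
/-- Every positive root is obtained from a starting root by applying `σ⁻¹` while it remains
positive. -/
lemma exists_eq_σ_inv_pow_start {φ : M} (hφ : φ ∈ positiveRoots b) :
    ∃ i ∈ b.support, ∃ k, 2 * k + c.color i < m ∧ φ = (c.σ⁻¹ ^ k) (c.start i) := by
  classical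
  have hex := p.exists_σ_pow_notMem hm₂ hm φ
  obtain ⟨K, hK⟩ : ∃ K, Nat.find hex = K + 1 :=
    Nat.exists_eq_succ_of_ne_zero fun h ↦ Nat.find_spec hex (by rw [h]; exact hφ)
  have hlt (k : ℕ) (hk : k ≤ K) : (c.σ ^ k) φ ∈ positiveRoots b := by
    by_contra h
    have := Nat.find_min' hex h
    lia
  have hspec := Nat.find_spec hex
  rw [hK, pow_succ', LinearEquiv.mul_apply] at hspec
  obtain ⟨i, hi, hi'⟩ := c.exists_eq_start (hlt K le_rfl) hspec
  have hφi : φ = (c.σ⁻¹ ^ K) (c.start i) := by rw [← hi', c.σ_inv_pow_σ_pow]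
  refine ⟨i, hi, K, ?_, hφi⟩
  by_contra! hge
  have hcol := c.color_le_one i
  -- The least k with 2k + ε ≥ m: on a longer run the root σ^{-k}(`start i`) = σ^{K-k} φ would be
  -- both positive and negative.
  obtain ⟨k, hk, hk₁, hk₂⟩ : ∃ k ≤ K, m ≤ 2 * k + c.color i ∧ 2 * k + c.color i < 2 * m :=
    ⟨(m - c.color i + 1) / 2, by lia, by lia, by lia⟩
  refine p.σ_inv_pow_start_notMem hm hi hk₁ hk₂ ?_
  convert hlt (K - k) (by lia) using 1
  rw [hφi]
  obtain ⟨l, rfl⟩ := Nat.exists_eq_add_of_le' hk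
  rw [Nat.add_sub_cancel, pow_add, LinearEquiv.mul_apply, c.σ_pow_σ_inv_pow]

include hm in
-- If the exponents differed, cancelling the common power would make σ(`start i`) a member of
-- another positive run, although it is negative.
lemma σ_inv_pow_start_inj {i j : ι} (hi : i ∈ b.support) (hj : j ∈ b.support) {k l : ℕ}
    (hk : 2 * k + c.color i < m) (hl : 2 * l + c.color j < m)
    (h : (c.σ⁻¹ ^ k) (c.start i) = (c.σ⁻¹ ^ l) (c.start j)) : i = j ∧ k = l := by
  have key {i j : ι} (hi : i ∈ b.support) (hj : j ∈ b.support) {k l : ℕ}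
      (hl : 2 * (k + (l + 1)) + c.color j < m) :
      (c.σ⁻¹ ^ k) (c.start i) ≠ (c.σ⁻¹ ^ (k + (l + 1))) (c.start j) := by
    intro h
    rw [pow_add, LinearEquiv.mul_apply] at h
    have h' := (c.σ⁻¹ ^ k).injective h
    refine c.σ_start_notMem hi ?_
    rw [h', pow_succ', LinearEquiv.mul_apply, c.σ_σ_inv]
    exact p.σ_inv_pow_start_mem hm hj (by lia)
  rcases lt_trichotomy k l with hkl | rfl | hkl
  · obtain ⟨d, rfl⟩ := Nat.exists_eq_add_of_lt hkl
    exact absurd h (key hi hj hl)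
  · exact ⟨c.start_injOn hi hj ((c.σ⁻¹ ^ k).injective h), rfl⟩
  · obtain ⟨d, rfl⟩ := Nat.exists_eq_add_of_lt hkl
    exact absurd h.symm (key hj hi hk)

/-- When D₂ φ = 0, τ₁ negates D₁ + D₂ at φ, so τ₁ φ is negative. -/
lemma mem_I₁_of_D₂_eq_zero {φ : M} (hφ : φ ∈ positiveRoots b) (h : p.D₂ φ = 0) :
    ∃ i ∈ c.I₁, φ = P.root i := by
  refine c.mem_I₁_of_τ₁_notMem hφ fun hpos ↦ ?_
  have h₁ := p.D₁_add_D₂_pos hφ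
  have h₂ := p.D₁_add_D₂_pos hpos
  rw [AddMonoidHom.add_apply] at h₁ h₂
  rw [p.D₁_τ₁, p.D₂_τ₁, h] at h₂
  rw [h] at h₁
  linarith

lemma mem_I₂_of_D₁_eq_zero {φ : M} (hφ : φ ∈ positiveRoots b) (h : p.D₁ φ = 0) :
    ∃ i ∈ c.I₂, φ = P.root i := by
  refine c.mem_I₂_of_τ₂_notMem hφ fun hpos ↦ ?_
  have h₁ := p.D₁_add_D₂_pos hφ
  have h₂ := p.D₁_add_D₂_pos hpos
  rw [AddMonoidHom.add_apply] at h₁ h₂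
  rw [p.D₁_τ₂, p.D₂_τ₂, h] at h₂
  rw [h] at h₁
  linarith

/-- If the order of the rotation of the Coxeter plane is odd, the two parts have equal size. -/
lemma card_I₁_eq_card_I₂ (hm : m * p.angle = Real.pi) (hodd : Odd m) :
    c.I₁.card = c.I₂.card := by
  obtain ⟨r, hr⟩ := hodd
  have hsin : Real.sin p.angle ≠ 0 :=
    (Real.sin_pos_of_pos_of_lt_pi p.angle_pos (by linarith [p.angle_le, Real.pi_pos])).ne'
  apply le_antisymm
  -- `G 1` is sin θ times `D₁`, and with m = 2r + 1 the phase 1 + 2r is a half-turn: `D₁` vanishes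
  -- on σ^{-r} α_i. The converse inequality uses `G 0` and `D₂`, with a sign because that root is
  -- negative.
  · have hex (i : ι) (hi : i ∈ c.I₁) : ∃ j ∈ c.I₂, (c.σ⁻¹ ^ r) (P.root i) = P.root j := by
      have hib := c.I₁_subset hi
      rw [← c.start_of_mem_I₁ hi]
      have hcol := c.color_of_mem_I₁ hi
      refine p.mem_I₂_of_D₁_eq_zero (p.σ_inv_pow_start_mem hm hib (by lia)) ?_
      have h := p.G_σ_inv_pow_start hib r 1
      rw [G_apply, hcol, show (1 + (2 * r + 0 : ℕ) : ℝ) * p.angle = Real.pi by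
        rw [← hm, hr]; push_cast; ring] at h
      simpa [hsin] using h
    choose! f hf hf' using hex
    refine Finset.card_le_card_of_injOn f hf fun i hi j hj hij ↦ ?_
    apply P.root.injective
    apply (c.σ⁻¹ ^ r).injective
    rw [hf' i hi, hf' j hj, hij]
  · have hex (i : ι) (hi : i ∈ c.I₂) : ∃ j ∈ c.I₁, -(c.σ⁻¹ ^ r) (c.start i) = P.root j := by
      have hib := c.I₂_subset hi
      have hcol := c.color_of_mem_I₂ hi
      have hmem := c.σ_inv_pow_mem_roots (c.start_mem_positiveRoots hib).1 r
      refine p.mem_I₁_of_D₂_eq_zero ((neg_mem_positiveRoots_iff hmem).mpr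
        (p.σ_inv_pow_start_notMem hm hib (by lia) ?_)) ?_
      · rcases Nat.eq_zero_or_pos r with rfl | hr₀
        · have h₁ : m = 1 := by lia
          have := p.angle_le
          rw [h₁, Nat.cast_one, one_mul] at hm
          linarith [Real.pi_pos]
        · lia
      · have h := p.G_σ_inv_pow_start hib r 0
        rw [G_apply, hcol, show (0 + (2 * r + 1 : ℕ) : ℝ) * p.angle = Real.pi by
          rw [← hm, hr]; push_cast; ring] at h
        simpa [hsin] using h
    choose! f hf hf' using hex
    refine Finset.card_le_card_of_injOn f hf fun i hi j hj hij ↦ ?_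
    apply c.start_injOn (c.I₂_subset hi) (c.I₂_subset hj)
    apply (c.σ⁻¹ ^ r).injective
    rw [← neg_inj, hf' i hi, hf' j hj, hij]

end Finite

end CoxeterPlane

end CoxeterOrbit

namespace CoxeterOrbit

/-! ### Counting the roots. -/

section Count

variable {ι M N : Type*} [AddCommGroup M] [Module ℂ M]
  [AddCommGroup N] [Module ℂ N] {P : RootPairing ι ℂ M N} {b : P.Base}
  [Finite ι]

variable (b) in
lemma card_eq_two_mul_ncard_positiveRoots : Nat.card ι = 2 * (positiveRoots b).ncard := by
  have hu : roots P = positiveRoots b ∪ Neg.neg '' positiveRoots b := by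
    ext φ
    refine ⟨fun h ↦ ?_, ?_⟩
    · by_cases hφ : φ ∈ positiveRoots b
      · exact .inl hφ
      · exact .inr ⟨-φ, (neg_mem_positiveRoots_iff h).mpr hφ, neg_neg φ⟩
    · rintro (h | ⟨ψ, h, rfl⟩)
      · exact h.1
      · exact neg_mem_roots h.1
  have hdisj : Disjoint (positiveRoots b) (Neg.neg '' positiveRoots b) := by
    rw [Set.disjoint_left]
    rintro _ h ⟨ψ, hψ, rfl⟩
    exact (neg_mem_positiveRoots_iff hψ.1).mp h hψ
  have hfin : (roots P).Finite := Set.finite_range _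
  have hfin' : (positiveRoots b).Finite := hfin.subset (positiveRoots_subset_roots b)
  rw [← Nat.card_range_of_injective P.root.injective, Nat.card_coe_set_eq]
  change (roots P).ncard = _
  rw [hu, Set.ncard_union_eq hdisj hfin' (hfin'.image _), Set.ncard_image_of_injective _ neg_injective,
    two_mul]

variable [P.IsCrystallographic] [P.IsReduced] {c : SimplePartition b} (p : CoxeterPlane c)

lemma CoxeterPlane.ncard_positiveRoots {m : ℕ} (hm₂ : 2 ≤ m) (hm : m * p.angle = Real.pi) :
    (positiveRoots b).ncard = ∑ i ∈ b.support, (m + 1 - c.color i) / 2 := by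
  classical
  -- (m + 1 - ε) / 2 is the number of k with 2k + ε < m.
  let S : Finset (Σ _ : ι, ℕ) := b.support.sigma fun i ↦ Finset.range ((m + 1 - c.color i) / 2)
  have hS (x : Σ _ : ι, ℕ) : x ∈ S ↔ x.1 ∈ b.support ∧ 2 * x.2 + c.color x.1 < m := by
    have := c.color_le_one x.1
    simp only [S, Finset.mem_sigma, Finset.mem_range]
    refine and_congr_right fun _ ↦ ⟨fun _ ↦ by lia, fun _ ↦ by lia⟩
  let f : (Σ _ : ι, ℕ) → M := fun x ↦ (c.σ⁻¹ ^ x.2) (c.start x.1)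
  have himage : positiveRoots b = f '' S := by
    ext φ
    refine ⟨fun hφ ↦ ?_, ?_⟩
    · obtain ⟨i, hi, k, hk, rfl⟩ := p.exists_eq_σ_inv_pow_start hm₂ hm hφ
      exact ⟨⟨i, k⟩, (hS _).mpr ⟨hi, hk⟩, rfl⟩
    · rintro ⟨x, hx, rfl⟩
      obtain ⟨hi, hk⟩ := (hS x).mp hx
      exact p.σ_inv_pow_start_mem hm hi hk
  have hinj : Set.InjOn f S := by
    rintro ⟨i, k⟩ hx ⟨j, l⟩ hy h
    obtain ⟨hi, hk⟩ := (hS _).mp hx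
    obtain ⟨hj, hl⟩ := (hS _).mp hy
    obtain ⟨rfl, rfl⟩ := p.σ_inv_pow_start_inj hm hi hj hk hl h
    rfl
  rw [himage, hinj.ncard_image, Set.ncard_coe_finset, Finset.card_sigma]
  simp

/-- The number of roots is the rank times the order of the rotation of the Coxeter plane. -/
lemma CoxeterPlane.card_eq {m : ℕ} (hm₂ : 2 ≤ m) (hm : m * p.angle = Real.pi) :
    Nat.card ι = b.support.card * m := by
  classical
  rw [card_eq_two_mul_ncard_positiveRoots b, p.ncard_positiveRoots hm₂ hm]
  -- The parity of m is not yet known, as this count is what identifies m with h. For m = 2r + 1 the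
  -- runs have length r + 1 or r by colour, and they average to m/2 because the two parts have equal
  -- size.
  rcases Nat.even_or_odd' m with ⟨r, hr | hr⟩
  · rw [Finset.sum_congr rfl (g := fun _ ↦ r) fun i _ ↦ by
      have := c.color_le_one i
      lia, Finset.sum_const, hr, smul_eq_mul]
    ring
  · have hu : b.support = c.I₁ ∪ c.I₂ := by
      ext i
      simp [c.mem_support_iff]
    rw [hu, Finset.sum_union c.disjoint, Finset.card_union_of_disjoint c.disjoint,
      p.card_I₁_eq_card_I₂ hm ⟨r, hr⟩,
      Finset.sum_congr rfl (g := fun _ ↦ r + 1) fun i hi ↦ by rw [c.color_of_mem_I₁ hi]; lia,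
      Finset.sum_congr (s₁ := c.I₂) rfl (g := fun _ ↦ r) fun i hi ↦ by
        rw [c.color_of_mem_I₂ hi]; lia,
      Finset.sum_const, Finset.sum_const, p.card_I₁_eq_card_I₂ hm ⟨r, hr⟩, hr, smul_eq_mul,
      smul_eq_mul]
    ring

end Count

/-! ### Dimension of 𝔤 from its root space decomposition. -/

section Lie

variable {𝔤 : Type*} [LieRing 𝔤] [LieAlgebra ℂ 𝔤] [FiniteDimensional ℂ 𝔤]
    [LieAlgebra.IsKilling ℂ 𝔤] (H : LieSubalgebra ℂ 𝔤) [H.IsCartanSubalgebra]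

/-- The root space decomposition, in terms of dimensions. -/
lemma finrank_eq_add_card_root [Nontrivial H] :
    finrank ℂ 𝔤 = finrank ℂ H + H.root.card := by
  classical
  have hzero : (LieAlgebra.rootSpace H (0 : H → ℂ)).toSubmodule = H.toSubmodule := by
    rw [← LieAlgebra.coe_zeroRootSubalgebra, LieAlgebra.zeroRootSubalgebra_eq_of_is_cartan]
  have hfr (χ : LieModule.Weight ℂ H 𝔤) :
      finrank ℂ (LieAlgebra.rootSpace H χ).toSubmodule = if χ.IsZero then finrank ℂ H else 1 := by
    split_ifs with h
    · rw [show (χ : H → ℂ) = 0 from h, hzero]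
      rfl
    · exact LieAlgebra.IsKilling.finrank_rootSpace_eq_one χ h
  have hds := DirectSum.isInternal_submodule_of_iSupIndep_of_iSup_eq_top
    (LieSubmodule.iSupIndep_toSubmodule.mpr <| LieModule.iSupIndep_genWeightSpace' ℂ H 𝔤)
    (LieSubmodule.iSup_toSubmodule_eq_top.mpr <| LieModule.iSup_genWeightSpace_eq_top' ℂ H 𝔤)
  rw [← (LinearEquiv.ofBijective (DirectSum.coeLinearMap _) hds).finrank_eq, Module.finrank_directSum,
    Finset.sum_congr rfl fun χ _ ↦ hfr χ, Finset.sum_ite, Finset.sum_const, Finset.sum_const]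
  have hne : LieAlgebra.rootSpace H (0 : H → ℂ) ≠ ⊥ := by
    intro h
    rw [h, LieSubmodule.bot_toSubmodule] at hzero
    have := (Submodule.nontrivial_iff_ne_bot (p := H.toSubmodule)).mp ‹_›
    exact this hzero.symm
  have hone : (Finset.univ.filter fun χ : LieModule.Weight ℂ H 𝔤 ↦ χ.IsZero) = {⟨0, hne⟩} := by
    ext χ
    simp only [Finset.mem_filter, Finset.mem_univ, true_and, Finset.mem_singleton]
    exact LieModule.Weight.ext_iff' (χ₂ := ⟨0, hne⟩)
  rw [hone, Finset.card_singleton, one_smul, smul_eq_mul, mul_one]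
  congr 2
  ext χ
  simp

end Lie

/-! ### Symmetry of the Cartan matrix in types A, D, E. -/

section TypeADE

variable {ι R M N : Type*} [CommRing R] [AddCommGroup M] [Module R M]
  [AddCommGroup N] [Module R N] {P : RootPairing ι R M N} [P.IsCrystallographic] {b : P.Base}

lemma cartanMatrix_symm_of_hasCartanMatrix {n : ℕ} {C : Matrix (Fin n) (Fin n) ℤ} (hC : C.IsSymm)
    (h : HasCartanMatrix b C) (i j : b.support) : b.cartanMatrix i j = b.cartanMatrix j i := by
  obtain ⟨e, he⟩ := h
  rw [he, he, hC.apply]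

lemma IsTypeADE.cartanMatrix_symm (h : IsTypeADE b) (i j : b.support) :
    b.cartanMatrix i j = b.cartanMatrix j i := by
  rcases h with ⟨n, -, h⟩ | ⟨n, -, h⟩ | h | h | h
  · exact cartanMatrix_symm_of_hasCartanMatrix (CartanMatrix.A_isSymm n) h i j
  · exact cartanMatrix_symm_of_hasCartanMatrix (CartanMatrix.D_isSymm n) h i j
  · exact cartanMatrix_symm_of_hasCartanMatrix CartanMatrix.E₆_isSymm h i j
  · exact cartanMatrix_symm_of_hasCartanMatrix CartanMatrix.E₇_isSymm h i j
  · exact cartanMatrix_symm_of_hasCartanMatrix CartanMatrix.E₈_isSymm h i j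

end TypeADE

/-! ### Positive orbits and the levels n(φ) when m = 2g. -/

section Levels

variable {ι M N : Type*} [AddCommGroup M] [Module ℂ M]
  [AddCommGroup N] [Module ℂ N] {P : RootPairing ι ℂ M N} {b : P.Base}
  [Finite ι] [P.IsCrystallographic] [P.IsReduced] {c : SimplePartition b} (p : CoxeterPlane c)
  {g : ℕ}

namespace CoxeterPlane

variable (hm₂ : 2 ≤ 2 * g) (hm : (2 * g : ℕ) * p.angle = Real.pi)

include hm in
lemma σ_inv_pow_start_mem_posOrbit {i : ι} (hi : i ∈ b.support) {k : ℕ} (hk : k < g) :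
    (c.σ⁻¹ ^ k) (c.start i) ∈ c.posOrbit i := by
  have hcol := c.color_le_one i
  refine ⟨p.σ_inv_pow_start_mem hm hi (by lia), ⟨⟨c.σ⁻¹ ^ k * (c.σ⁻¹) ^ c.color i, ?_⟩, ?_⟩⟩
  · have h := inv_mem (Subgroup.mem_zpowers c.σ)
    exact mul_mem (pow_mem h k) (pow_mem h _)
  · change (c.σ⁻¹ ^ k * (c.σ⁻¹) ^ c.color i) (c.β i) = _
    rw [c.β_eq_σ_pow_start hi, LinearEquiv.mul_apply, c.σ_inv_pow_σ_pow]

include hm hm₂ in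
lemma exists_eq_of_mem_posOrbit {i : ι} (hi : i ∈ b.support) {φ : M} (hφ : φ ∈ c.posOrbit i) :
    ∃ k < g, φ = (c.σ⁻¹ ^ k) (c.start i) := by
  obtain ⟨hpos, ⟨⟨w, hw⟩, rfl⟩⟩ := hφ
  obtain ⟨z, rfl⟩ := hw
  have hone := p.σ_pow_eq_one hm
  have horb : (c.σ ^ z) (c.β i) = (c.σ ^ (z + c.color i)) (c.start i) := by
    rw [c.β_eq_σ_pow_start hi, zpow_add, LinearEquiv.mul_apply, zpow_natCast]
  change (c.σ ^ z) (c.β i) ∈ _ at hpos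
  change ∃ k < g, (c.σ ^ z) (c.β i) = _
  rw [horb] at hpos ⊢
  set y := z + c.color i
  have hg₀ : (0 : ℤ) < (2 * g : ℕ) := by lia
  -- Since σ^{2g} = 1, the exponent reduces to -k with 0 ≤ k < 2g; the half g ≤ k < 2g consists of
  -- negative roots.
  obtain ⟨k, hk⟩ : ∃ k : ℕ, (k : ℤ) = (-y) % (2 * g : ℕ) :=
    ⟨_, Int.toNat_of_nonneg (Int.emod_nonneg _ hg₀.ne')⟩
  have hk_lt : k < 2 * g := by
    have := Int.emod_lt_of_pos (-y) hg₀
    lia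
  have hpow : c.σ ^ y = c.σ⁻¹ ^ k := by
    have h₁ : c.σ⁻¹ ^ k = c.σ⁻¹ ^ (-y) := by
      rw [← zpow_natCast, hk]
      conv_rhs => rw [← Int.emod_add_mul_ediv (-y) (2 * g : ℕ), zpow_add, zpow_mul, zpow_natCast,
        inv_pow, hone]
      simp
    rw [h₁]
    simp
  rw [hpow] at hpos ⊢
  refine ⟨k, ?_, rfl⟩
  by_contra! hge
  have hcol := c.color_le_one i
  exact p.σ_inv_pow_start_notMem hm hi (k := k) (by lia) (by lia) hpos

include hm hm₂ in
lemma eq_of_mem_posOrbit {i j : ι} (hi : i ∈ b.support) (hj : j ∈ b.support) {φ : M}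
    (hφi : φ ∈ c.posOrbit i) (hφj : φ ∈ c.posOrbit j) : i = j := by
  obtain ⟨k, hk, rfl⟩ := p.exists_eq_of_mem_posOrbit hm₂ hm hi hφi
  obtain ⟨l, hl, h⟩ := p.exists_eq_of_mem_posOrbit hm₂ hm hj hφj
  have := c.color_le_one i
  have := c.color_le_one j
  exact (p.σ_inv_pow_start_inj hm hi hj (by lia) (by lia) h).1

include hm in
/-- The power of `σ` which takes a root of the positive run to the start of the run is unique. -/
lemma eq_of_σ_pow_eq_β {i : ι} (hi : i ∈ b.support) {k l : ℕ} (hk : k < g) (hl : l < g)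
    (h : (c.σ ^ (l + c.color i)) ((c.σ⁻¹ ^ k) (c.start i)) = c.β i) : l = k := by
  have := c.color_le_one i
  rw [c.β_eq_σ_pow_start hi, add_comm, pow_add, LinearEquiv.mul_apply] at h
  have h' := congrArg (c.σ⁻¹ ^ l) ((c.σ ^ c.color i).injective h)
  rw [c.σ_inv_pow_σ_pow] at h'
  exact (p.σ_inv_pow_start_inj hm hi hi (by lia) (by lia) h').2.symm

include hm hm₂ in
-- From σ^{-k}(`start i`) it takes k + ε steps to reach β_i, and injectivity of the run excludes any
-- other admissible exponent.
lemma isLevel_iff {i : ι} (hi : i ∈ b.support) {k : ℕ} (hk : k < g) (n : ℕ) :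
    c.IsLevel (2 * g) ((c.σ⁻¹ ^ k) (c.start i)) n ↔ n = 2 * k + 1 + c.color i := by
  have hmem := p.σ_inv_pow_start_mem_posOrbit hm hi hk
  constructor
  · rintro ⟨hn₁, hn₂, ⟨j, hj, hφ, ⟨l, hl⟩, h⟩ | ⟨j, hj, hφ, ⟨l, hl⟩, h⟩⟩
    · obtain rfl := p.eq_of_mem_posOrbit hm₂ hm (c.I₁_subset hj) hi hφ hmem
      have hcol := c.color_of_mem_I₁ hj
      have := p.eq_of_σ_pow_eq_β hm hi hk (l := l) (by lia)
        (by rw [← h, hcol]; congr 2; lia)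
      lia
    · obtain rfl := p.eq_of_mem_posOrbit hm₂ hm (c.I₂_subset hj) hi hφ hmem
      have hcol := c.color_of_mem_I₂ hj
      -- For Π₂ the element β_i lies one step beyond the start, whence the shift; l ≥ 1 because n ≥
      -- 1.
      have := p.eq_of_σ_pow_eq_β hm hi hk (l := l - 1) (by lia)
        (by rw [← h, hcol]; congr 2; lia)
      lia
  · rintro rfl
    have hcol := c.color_le_one i
    have hβ : (c.σ ^ (k + c.color i)) ((c.σ⁻¹ ^ k) (c.start i)) = c.β i := by
      rw [c.β_eq_σ_pow_start hi, add_comm, pow_add, LinearEquiv.mul_apply,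
        c.σ_pow_σ_inv_pow]
    refine ⟨by lia, by lia, ?_⟩
    rcases (c.mem_support_iff i).mp hi with h | h
    · rw [c.color_of_mem_I₁ h] at hβ ⊢
      refine .inl ⟨i, h, hmem, ⟨k, rfl⟩, ?_⟩
      rw [← hβ]
      congr 2
      lia
    · rw [c.color_of_mem_I₂ h] at hβ ⊢
      refine .inr ⟨i, h, hmem, ⟨k + 1, by lia⟩, ?_⟩
      rw [← hβ]
      congr 2
      lia

include hm hm₂ in
lemma level_eq {i : ι} (hi : i ∈ b.support) {k : ℕ} (hk : k < g) :
    c.level (2 * g) ((c.σ⁻¹ ^ k) (c.start i)) = 2 * k + 1 + c.color i := by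
  have : {n | c.IsLevel (2 * g) ((c.σ⁻¹ ^ k) (c.start i)) n} = {2 * k + 1 + c.color i} :=
    Set.ext fun n ↦ p.isLevel_iff hm₂ hm hi hk n
  rw [SimplePartition.level, this, csInf_singleton]

include hm hm₂ in
/-- A function which counts the steps of the run of `start i`, up to a shift, is a bijection. -/
lemma bijOn_of_σ_inv_pow_start {i : ι} (hi : i ∈ b.support) (f : M → ℕ) (s : Set ℕ)
    (d : ℕ) (hf : ∀ k < g, f ((c.σ⁻¹ ^ k) (c.start i)) = k + d)
    (hs : ∀ n, n ∈ s ↔ ∃ k < g, n = k + d) : Set.BijOn f (c.posOrbit i) s := by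
  refine ⟨fun φ hφ ↦ ?_, fun φ hφ ψ hψ h ↦ ?_, fun n hn ↦ ?_⟩
  · obtain ⟨k, hk, rfl⟩ := p.exists_eq_of_mem_posOrbit hm₂ hm hi hφ
    exact (hs _).mpr ⟨k, hk, hf k hk⟩
  · obtain ⟨k, hk, rfl⟩ := p.exists_eq_of_mem_posOrbit hm₂ hm hi hφ
    obtain ⟨l, hl, rfl⟩ := p.exists_eq_of_mem_posOrbit hm₂ hm hi hψ
    rw [hf k hk, hf l hl] at h
    rw [Nat.add_right_cancel h]
  · obtain ⟨k, hk, rfl⟩ := (hs n).mp hn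
    exact ⟨_, p.σ_inv_pow_start_mem_posOrbit hm hi hk, hf k hk⟩

end CoxeterPlane

end Levels

end CoxeterOrbit
end

theorem theorem1p12 {𝔤 : Type*} [LieRing 𝔤] [LieAlgebra ℂ 𝔤] [FiniteDimensional ℂ 𝔤]
    [LieAlgebra.IsSimple ℂ 𝔤] (H : LieSubalgebra ℂ 𝔤) [H.IsCartanSubalgebra]
    (b : (LieAlgebra.IsKilling.rootSystem H).Base)
    (hADE : CoxeterOrbit.IsTypeADE b)
    (c : CoxeterOrbit.SimplePartition b)
    (h g : ℕ) (hh : h = CoxeterOrbit.coxeterNumber H) (hg : h = 2 * g) :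
    (∀ φ ∈ CoxeterOrbit.positiveRoots b,
      (∃! i, i ∈ b.support ∧ φ ∈ c.posOrbit i) ∧ (∃! n, c.IsLevel h φ n)) ∧
    (∀ i ∈ c.I₁,
      Set.BijOn (fun φ ↦ (c.level h φ - 1) / 2) (c.posOrbit i) {k | k < g}) ∧
    (∀ i ∈ c.I₂,
      Set.BijOn (fun φ ↦ c.level h φ / 2) (c.posOrbit i) {k | 1 ≤ k ∧ k ≤ g}) := by
  have hirr : (LieAlgebra.IsKilling.rootSystem H).IsIrreducible := inferInstance
  have hdual : Nontrivial (Dual ℂ H) := hirr.nontrivial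
  have : Nonempty H.root := by
    by_contra hempty
    rw [not_nonempty_iff] at hempty
    have hspan := RootPairing.IsRootSystem.span_root_eq_top (P := LieAlgebra.IsKilling.rootSystem H)
    rw [Set.range_eq_empty, Submodule.span_empty] at hspan
    exact bot_ne_top hspan
  have hH : Nontrivial H := by
    by_contra hH
    rw [not_nontrivial_iff_subsingleton] at hH
    exact not_subsingleton (Dual ℂ H) inferInstance
  obtain ⟨p⟩ := CoxeterOrbit.nonempty_coxeterPlane c hADE.cartanMatrix_symm
  obtain ⟨m, hm₂, hm⟩ := p.exists_mul_angle_eq_pi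
  have hrank : finrank ℂ H = b.support.card := by
    rw [← Subspace.dual_finrank_eq, finrank_eq_card_basis b.toWeightBasis, Fintype.card_coe]
  have hroot : H.root.card = b.support.card * m := by
    rw [← p.card_eq hm₂ hm, Nat.card_eq_fintype_card, Fintype.card_coe]
  have hpos : 0 < b.support.card := b.support_nonempty.card_pos
  -- dim 𝔤 = ℓ + ℓm, so the division and the subtraction defining `coxeterNumber` are exact and
  -- return m.
  have hhm : m = 2 * g := by
    rw [← hg, hh, CoxeterOrbit.coxeterNumber, CoxeterOrbit.finrank_eq_add_card_root H, hroot, hrank,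
      Nat.add_mul_div_left _ _ hpos, Nat.div_self hpos, Nat.add_sub_cancel_left]
  subst hhm hg
  refine ⟨fun φ hφ ↦ ?_, fun i hi ↦ ?_, fun i hi ↦ ?_⟩
  · obtain ⟨i, hi, k, hk, rfl⟩ := p.exists_eq_σ_inv_pow_start hm₂ hm hφ
    have hkg : k < g := by lia
    have hmem := p.σ_inv_pow_start_mem_posOrbit hm hi hkg
    exact ⟨⟨i, ⟨hi, hmem⟩, fun j hj ↦ p.eq_of_mem_posOrbit hm₂ hm hj.1 hi hj.2 hmem⟩,
      ⟨_, (p.isLevel_iff hm₂ hm hi hkg _).mpr rfl,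
        fun n hn ↦ (p.isLevel_iff hm₂ hm hi hkg n).mp hn⟩⟩
  · have hib := c.I₁_subset hi
    refine p.bijOn_of_σ_inv_pow_start hm₂ hm hib _ _ 0 (fun k hk ↦ ?_) fun n ↦ ?_
    · simp only [p.level_eq hm₂ hm hib hk, c.color_of_mem_I₁ hi]
      lia
    · simp
  · have hib := c.I₂_subset hi
    refine p.bijOn_of_σ_inv_pow_start hm₂ hm hib _ _ 1 (fun k hk ↦ ?_) fun n ↦ ?_
    · simp only [p.level_eq hm₂ hm hib hk, c.color_of_mem_I₂ hi]
      lia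
    · rw [Set.mem_ofPred_eq]
      exact ⟨fun hn ↦ ⟨n - 1, by lia, by lia⟩, fun ⟨k, hk, hn⟩ ↦ by lia⟩
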